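/- **Setting.** There are $N\ge 1$ real nodes and finitely many (possibly zero) virtual nodes; virtual nodes only relay delayed messages and have objective $0$. Real node $n$ has a sample law $\mathcal D_n$ and a stochastic cost $F_n(x,\xi_n)$, $x\in\mathbb R^d$; put $f_n(x)=\mathbb E_{\xi_n\sim\mathcal D_n}F_n(x,\xi_n)$ (assumed to exist) and $f=\frac1N\sum_{n=1}^N f_n$. In round $k=0,1,\dots$ the nodes use a (possibly random) real weight matrix $W^{[k]}$, indexed by all nodes, and fresh samples $\xi_n^{[k]}\sim\mathcal D_n$. The samples are independent over nodes and rounds, the matrices $W^{[k]}$ are independent over rounds, and the samples are independent of the matrices. **Algorithm (DT-GO, minimization phase, with exact correction weights).** All nodes start at the same point $x^{[0]}$. In round $k$ each real node forms $y=x_n^{[k]}-\eta\nabla F_n(x_n^{[k]},\xi_n^{[k]})$ and $z_n=x_n^{[k]}+\frac1{N\pi_n}(y-x_n^{[k]})$, each virtual node puts $z_n=x_n^{[k]}$, and then $x_n^{[k+1]}=\sum_m W^{[k]}_{nm}z_m$ for every node. Let $\tilde x^{[k]}=\sum_n\pi_n x_n^{[k]}$, summed over all nodes. **Assumption on the weights.**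 Products are time-ordered (later rounds on the left), $\|\cdot\|_2$ is the spectral norm, $D$ is diagonal with entries $\frac1{N\pi_n}$ at real nodes and $1$ at virtual nodes, and $J$ has all entries $1/N$. 1. $W^\infty=\lim_{k}\mathbb E[W^{[k]}\cdots W^{[0]}]$ exists, and $W^{[k]}W^\infty=W^\infty=W^\infty W^{[k]}$ almost surely for all $k$. 2. All rows of $W^\infty$ equal $\pi$, with $\pi_n\ge0$, $\sum_n\pi_n=1$, and $\pi_n>0$ for real nodes. 3. There are $0<p\le1$ and an integer $\tau\ge1$ with $\mathbb E\|W^\infty-W^{[k-1]}\cdots W^{[k-\tau]}\|_2^2\le1-p$ for all $k\ge\tau$. 4. There is $\beta>0$ with $\mathbb E\|W^{[k-1]}\cdots W^{[\ell]}D-J\|_2^2\le\beta^2$ for all $k\ge 1$ and all $\ell$ with $\max(0,k-\tau)\le\ell<k$. The bound $\beta$ is taken large enough that $\beta\tau\ge p$ (for example $\beta\ge1$). **Assumption on the costs.** Each $F_n(\cdot,\xi)$ is convex (so $f$ is convex), continuously differentiable, and has an $L$-Lipschitz gradient; $f$ has a global minimizer $x^\star$, with $f^\star=f(x^\star)$;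 and $\bar\zeta^2=\frac1N\sum_n\|\nabla f_n(x^\star)\|_2^2$ and $\bar\sigma^2=\frac1N\sum_n\mathbb E\|\nabla F_n(x^\star,\xi_n)-\nabla f_n(x^\star)\|_2^2$ are finite. **Theorem.** There is an absolute constant $C>0$ such that in every such setting and for every $\epsilon>0$ there is a constant step size $\eta>0$ for which all expectations $\mathbb E f(\tilde x^{[k]})$ exist and $$\frac1K\sum_{k=0}^{K-1}\mathbb E f(\tilde x^{[k]})-f^\star\le\epsilon$$ for every integer $K\ge1$ with $$K\ \ge\ C\left(\frac{\bar\sigma^2}{N\epsilon^2}+\frac{\beta\sqrt L\,(\bar\zeta\tau+\bar\sigma\sqrt{p\tau})}{p\,\epsilon^{3/2}}+\frac{\beta L\tau}{p\,\epsilon}\right)\|\tilde x^{[0]}-x^\star\|_2^2 .$$ -/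

import Mathlib

open MeasureTheory ProbabilityTheory Filter Topology

noncomputable section

namespace DTGO

/-! ### Cost functions

`ι` is the finite set of real (computing) nodes, `κ` the finite, possibly empty, set of virtual
nodes that relay delayed messages. `F n x z` is the cost of node `n` at the model `x` and the
sample `z`, and `𝒟 n` is the law of the samples of node `n`. -/

section Costs

variable {ι Ξ : Type*} [MeasurableSpace Ξ] {d : ℕ}

/-- `L`-smoothness: continuously differentiable with an `L`-Lipschitz gradient. -/
def LSmooth (L : ℝ) (g : EuclideanSpace ℝ (Fin d) → ℝ) : Prop :=
  ContDiff ℝ 1 g ∧ ∀ x y, ‖gradient g x - gradient g y‖ ≤ L * ‖x - y‖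

/-- The local objective `f_n(x) = E_{z ∼ 𝒟_n} F_n(x, z)`. -/
def localCost (𝒟 : ι → Measure Ξ) (F : ι → EuclideanSpace ℝ (Fin d) → Ξ → ℝ) (n : ι)
    (x : EuclideanSpace ℝ (Fin d)) : ℝ :=
  ∫ z, F n x z ∂(𝒟 n)

/-- The stochastic gradient `∇ F_n(x, z)`, the gradient being taken in `x`. -/
def stochGrad (F : ι → EuclideanSpace ℝ (Fin d) → Ξ → ℝ) (n : ι)
    (x : EuclideanSpace ℝ (Fin d)) (z : Ξ) : EuclideanSpace ℝ (Fin d) :=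
  gradient (fun y => F n y z) x

/-- The noise level `σ_n² = E ‖∇F_n(x⋆, z) - ∇f_n(x⋆)‖²` at the point `xs = x⋆`. -/
def noiseSq (𝒟 : ι → Measure Ξ) (F : ι → EuclideanSpace ℝ (Fin d) → Ξ → ℝ)
    (xs : EuclideanSpace ℝ (Fin d)) (n : ι) : ℝ :=
  ∫ z, ‖stochGrad F n xs z - gradient (localCost 𝒟 F n) xs‖ ^ 2 ∂(𝒟 n)

variable [Fintype ι]

/-- The global objective `f = (1/N) ∑ f_n`, where `N` is the number of real nodes. -/
def globalCost (𝒟 : ι → Measure Ξ) (F : ι → EuclideanSpace ℝ (Fin d) → Ξ → ℝ)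
    (x : EuclideanSpace ℝ (Fin d)) : ℝ :=
  (1 / (Fintype.card ι : ℝ)) * ∑ n, localCost 𝒟 F n x

/-- `σ̄`, with `σ̄² = (1/N) ∑ σ_n²`. -/
def noiseLevel (𝒟 : ι → Measure Ξ) (F : ι → EuclideanSpace ℝ (Fin d) → Ξ → ℝ)
    (xs : EuclideanSpace ℝ (Fin d)) : ℝ :=
  √((1 / (Fintype.card ι : ℝ)) * ∑ n, noiseSq 𝒟 F xs n)

/-- `ζ̄`, with `ζ̄² = (1/N) ∑ ‖∇f_n(x⋆)‖²`. -/
def heterogeneity (𝒟 : ι → Measure Ξ) (F : ι → EuclideanSpace ℝ (Fin d) → Ξ → ℝ)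
    (xs : EuclideanSpace ℝ (Fin d)) : ℝ :=
  √((1 / (Fintype.card ι : ℝ)) * ∑ n, ‖gradient (localCost 𝒟 F n) xs‖ ^ 2)

/-- The assumptions on the costs: the stochastic costs are convex and `L`-smooth in the model,
the local objectives are well defined, `xs` is a global minimizer of the global objective, and
the noise at `xs` is finite. -/
structure ConvexCosts (𝒟 : ι → Measure Ξ) (F : ι → EuclideanSpace ℝ (Fin d) → Ξ → ℝ)
    (L : ℝ) (xs : EuclideanSpace ℝ (Fin d)) : Prop where
  measurable : ∀ n x, Measurable (F n x)
  integrable : ∀ n x, Integrable (F n x) (𝒟 n)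
  convex : ∀ n z, ConvexOn ℝ Set.univ (fun x => F n x z)
  smooth : ∀ n z, LSmooth L (fun x => F n x z)
  minimizer : ∀ x, globalCost 𝒟 F xs ≤ globalCost 𝒟 F x
  finite_noise : ∀ n,
    Integrable (fun z => ‖stochGrad F n xs z - gradient (localCost 𝒟 F n) xs‖ ^ 2) (𝒟 n)

end Costs

/-! ### Weight matrices -/

section Gossip

variable {ι κ Ω : Type*} [Fintype ι] [DecidableEq ι] [Fintype κ] [DecidableEq κ]

/-- The spectral norm (operator 2-norm) of a square matrix. -/
def specNorm {V : Type*} [Fintype V] [DecidableEq V] (A : Matrix V V ℝ) : ℝ :=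
  ‖Matrix.toEuclideanCLM (n := V) (𝕜 := ℝ) A‖

/-- The time-ordered product `W^[s+r-1] ⋯ W^[s+1] W^[s]` over the `r` rounds that start with
round `s`: the matrix that maps the states of round `s` to those of round `s + r` when only
gossip steps are made. -/
def gossipProd {V : Type*} [Fintype V] [DecidableEq V] (W : ℕ → Ω → Matrix V V ℝ)
    (s : ℕ) : ℕ → Ω → Matrix V V ℝ
  | 0, _ => 1
  | r + 1, ω => W (s + r) ω * gossipProd W s r ω

/-- `W^∞`: every row is `π`. -/
def limitMatrix {V : Type*} (π : V → ℝ) : Matrix V V ℝ :=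
  Matrix.of fun _ j => π j

/-- The entries of the correction matrix: `1 / (N π_n)` at real nodes, `1` at virtual ones. -/
def correction (π : ι ⊕ κ → ℝ) : ι ⊕ κ → ℝ
  | .inl n => 1 / ((Fintype.card ι : ℝ) * π (.inl n))
  | .inr _ => 1

/-- `J`: all entries are `1 / N`, with `N` the number of real nodes. -/
def averageMatrix (ι κ : Type*) [Fintype ι] : Matrix (ι ⊕ κ) (ι ⊕ κ) ℝ :=
  Matrix.of fun _ _ => 1 / (Fintype.card ι : ℝ)

/-- The assumptions on the (random) weight matrices, with parameters `p`, `τ` and `β`.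
The communication graph of a round is the support of the weight matrix of that round, so it
does not appear separately. -/
structure GossipAssumption [MeasurableSpace Ω] (μ : Measure Ω)
    (W : ℕ → Ω → Matrix (ι ⊕ κ) (ι ⊕ κ) ℝ) (π : ι ⊕ κ → ℝ) (p : ℝ) (τ : ℕ) (β : ℝ) :
    Prop where
  /-- The expected products exist and converge to `W^∞`. -/
  integrable_prod : ∀ k i j, Integrable (fun ω => gossipProd W 0 (k + 1) ω i j) μ
  tendsto_prod : ∀ i j, Tendsto (fun k => ∫ ω, gossipProd W 0 (k + 1) ω i j ∂μ) atTop
    (𝓝 (limitMatrix π i j))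
  mul_limit : ∀ k, ∀ᵐ ω ∂μ, W k ω * limitMatrix π = limitMatrix π
  limit_mul : ∀ k, ∀ᵐ ω ∂μ, limitMatrix π * W k ω = limitMatrix π
  /-- The rows of `W^∞` are stochastic, and positive at the real nodes. -/
  nonneg : ∀ i, 0 ≤ π i
  sum_eq_one : ∑ i, π i = 1
  pos_real : ∀ n : ι, 0 < π (.inl n)
  /-- Contraction in mean square over any `τ` consecutive rounds. -/
  p_pos : 0 < p
  p_le_one : p ≤ 1
  one_le_tau : 1 ≤ τ
  contraction : ∀ s,
    Integrable (fun ω => specNorm (limitMatrix π - gossipProd W s τ ω) ^ 2) μ ∧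
      ∫ ω, specNorm (limitMatrix π - gossipProd W s τ ω) ^ 2 ∂μ ≤ 1 - p
  /-- Boundedness of the corrected products over at most `τ` consecutive rounds. -/
  beta_pos : 0 < β
  bounded : ∀ s r, 1 ≤ r → r ≤ τ →
    Integrable (fun ω => specNorm
        (gossipProd W s r ω * Matrix.diagonal (correction π) - averageMatrix ι κ) ^ 2) μ ∧
      ∫ ω, specNorm
        (gossipProd W s r ω * Matrix.diagonal (correction π) - averageMatrix ι κ) ^ 2 ∂μ
        ≤ β ^ 2

/-- The randomness: `ξ k n` is the sample drawn by node `n` in round `k`, with law `𝒟 n`. The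
samples are independent over nodes and rounds, the weight matrices are independent over
rounds, and the samples are independent of the weight matrices. -/
structure RandomModel {Ξ : Type*} [MeasurableSpace Ω] [MeasurableSpace Ξ] (μ : Measure Ω)
    (W : ℕ → Ω → Matrix (ι ⊕ κ) (ι ⊕ κ) ℝ) (𝒟 : ι → Measure Ξ) (ξ : ℕ → ι → Ω → Ξ) :
    Prop where
  measurable_weight : ∀ k i j, Measurable fun ω => W k ω i j
  measurable_sample : ∀ k n, Measurable (ξ k n)
  law : ∀ k n, μ.map (ξ k n) = 𝒟 n
  indep_weight : iIndepFun (fun k ω (i j : ι ⊕ κ) => W k ω i j) μ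
  indep_sample : iIndepFun (fun (i : ℕ × ι) => ξ i.1 i.2) μ
  indep : IndepFun (fun ω k (i j : ι ⊕ κ) => W k ω i j) (fun ω (i : ℕ × ι) => ξ i.1 i.2 ω) μ

end Gossip

/-! ### The algorithm -/

section Algorithm

variable {ι κ Ω Ξ : Type*} [Fintype ι] [Fintype κ] {d : ℕ}

/-- The state `z` that a node broadcasts in a round: a real node `n` makes the stochastic
gradient step `y = x_n - η ∇F_n(x_n, ξ_n)` and adjusts it to
`z_n = x_n + (1 / (N π_n)) (y - x_n)`; a virtual node (zero objective) relays its state. -/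
def localStep (F : ι → EuclideanSpace ℝ (Fin d) → Ξ → ℝ) (π : ι ⊕ κ → ℝ) (η : ℝ)
    (x : ι ⊕ κ → EuclideanSpace ℝ (Fin d)) (z : ι → Ξ) :
    ι ⊕ κ → EuclideanSpace ℝ (Fin d)
  | .inl n => x (.inl n) + (1 / ((Fintype.card ι : ℝ) * π (.inl n))) •
      ((x (.inl n) - η • stochGrad F n (x (.inl n)) (z n)) - x (.inl n))
  | .inr v => x (.inr v)

/-- The iterates `x_n^[k]` of DT-GO (its minimization phase, with the exact correction weights)
with constant step size `η`, all nodes being started at `x₀`. -/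
def iterate (W : ℕ → Ω → Matrix (ι ⊕ κ) (ι ⊕ κ) ℝ)
    (F : ι → EuclideanSpace ℝ (Fin d) → Ξ → ℝ) (π : ι ⊕ κ → ℝ) (ξ : ℕ → ι → Ω → Ξ)
    (η : ℝ) (x₀ : EuclideanSpace ℝ (Fin d)) :
    ℕ → Ω → ι ⊕ κ → EuclideanSpace ℝ (Fin d)
  | 0, _ => fun _ => x₀
  | k + 1, ω => fun i =>
      ∑ j, W k ω i j • localStep F π η (iterate W F π ξ η x₀ k ω) (fun n => ξ k n ω) j

/-- The weighted average `x̃ = ∑ π_i x_i` of the states. -/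
def weightedAverage (π : ι ⊕ κ → ℝ) (x : ι ⊕ κ → EuclideanSpace ℝ (Fin d)) :
    EuclideanSpace ℝ (Fin d) :=
  ∑ i, π i • x i

end Algorithm

/-- The order of the number of iterations, up to the factor `‖x̃^[0] - x⋆‖²`. -/
def iterationOrder (N : ℕ) (L β p : ℝ) (τ : ℕ) (σ ζ ε : ℝ) : ℝ :=
  σ ^ 2 / (N * ε ^ 2) + β * √L * (ζ * τ + σ * √(p * τ)) / (p * ε ^ (3 / 2 : ℝ))
    + β * L * τ / (p * ε)

end DTGO

end

/-
The average `x̃` of the states performs gradient descent with inexact gradients: as `W^∞` absorbs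
every round, `x̃` moves by `-η` times the mean of the local gradients, taken at the states `x_n`
instead of `x̃`, plus noise. By convexity and smoothness one round lowers `E‖x̃ - x⋆‖²` by about
`2 η E(f(x̃) - f⋆)`, up to `η L / N` times the squared deviation `U = E ∑_n ‖x_n - x̃‖²` and the
noise `η² σ̄² / N`.

The deviations are contracted by `1 - p` over `τ` rounds and driven by the steps taken meanwhile.
Young's inequality with weight `p / 2` splits off the exact gradients, which add up coherently
over the block and cost a factor `τ / p`; the noise is centred and independent of the past, so it
is orthogonal to everything else and enters with its variance only. Smoothness bounds gradients
and noise by `3 L² U + 6 L N E(f(x̃) - f⋆)` plus the levels `3 N ζ̄²` and `3 N σ̄²` at `x⋆`.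
Summing over the rounds, with `40 η` at most the inverse of `ε` times the bracket in the bound for
`K`, the multiples of `U` and of the gap on the right are absorbed on the left.
-/

noncomputable section

namespace DTGO

/-! ### Smooth convex functions -/

section Convex

variable {E : Type*} [NormedAddCommGroup E] [InnerProductSpace ℝ E]

/-- The first-order form of convexity and `L`-smoothness: `g` lies above its linear
approximations with slopes `g'` and below its quadratic approximations of curvature `L`. It is
stable under averaging, which makes it the convenient form for the local and global costs. -/
structure SmoothConvex (L : ℝ) (g : E → ℝ) (g' : E → E) : Prop where
  nonneg : 0 ≤ L
  lower : ∀ x y, g x + inner ℝ (g' x) (y - x) ≤ g y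
  upper : ∀ x y, g y ≤ g x + inner ℝ (g' x) (y - x) + L / 2 * ‖y - x‖ ^ 2

/-- The Bregman divergence of `g`, with `g'` in the role of the gradient. -/
def bregman (g : E → ℝ) (g' : E → E) (x y : E) : ℝ :=
  g x - g y - inner ℝ (g' y) (x - y)

namespace SmoothConvex

variable {L : ℝ} {g : E → ℝ} {g' : E → E}

theorem bregman_nonneg (h : SmoothConvex L g g') (x y : E) : 0 ≤ bregman g g' x y := by
  have := h.lower y x
  unfold bregman
  linarith

theorem bregman_le (h : SmoothConvex L g g') (x y : E) :
    bregman g g' x y ≤ L / 2 * ‖x - y‖ ^ 2 := by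
  have := h.upper y x
  unfold bregman
  linarith

/-- Obtained by comparing the linear lower bound at `y` with the quadratic upper bound at `x`
in the point `x - t (g' x - g' y)`. -/
theorem bregman_ge_of_step (h : SmoothConvex L g g') (x y : E) (t : ℝ) :
    t * ‖g' x - g' y‖ ^ 2 - L / 2 * t ^ 2 * ‖g' x - g' y‖ ^ 2 ≤ bregman g g' x y := by
  have hlower := h.lower y (x - t • (g' x - g' y))
  have hupper := h.upper x (x - t • (g' x - g' y))
  rw [show x - t • (g' x - g' y) - y = (x - y) - t • (g' x - g' y) by abel, inner_sub_right,
    inner_smul_right] at hlower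
  rw [show x - t • (g' x - g' y) - x = -(t • (g' x - g' y)) by abel, norm_neg, norm_smul,
    mul_pow, Real.norm_eq_abs, sq_abs, inner_neg_right, inner_smul_right] at hupper
  have hinner : inner ℝ (g' x) (g' x - g' y) - inner ℝ (g' y) (g' x - g' y)
      = ‖g' x - g' y‖ ^ 2 := by
    rw [← inner_sub_left, real_inner_self_eq_norm_sq]
  unfold bregman
  rw [← hinner] at hupper ⊢
  linarith

theorem norm_grad_sub_sq_le (h : SmoothConvex L g g') (x y : E) :
    ‖g' x - g' y‖ ^ 2 ≤ 2 * L * bregman g g' x y := by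
  have hB := h.bregman_nonneg x y
  rcases (sq_nonneg ‖g' x - g' y‖).eq_or_lt with h0 | hpos
  · rw [← h0]
    exact mul_nonneg (mul_nonneg zero_le_two h.nonneg) hB
  · have hdiscrim : discrim (L / 2 * ‖g' x - g' y‖ ^ 2) (-‖g' x - g' y‖ ^ 2)
        (bregman g g' x y) ≤ 0 :=
      discrim_le_zero fun t => by linarith [h.bregman_ge_of_step x y t]
    rw [discrim] at hdiscrim
    refine le_of_mul_le_mul_right ?_ hpos
    linarith

theorem norm_grad_sub_le (h : SmoothConvex L g g') (x y : E) :
    ‖g' x - g' y‖ ≤ L * ‖x - y‖ := by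
  have hL := h.nonneg
  refine (pow_le_pow_iff_left₀ (norm_nonneg _) (by positivity) two_ne_zero).1 ?_
  calc ‖g' x - g' y‖ ^ 2 ≤ 2 * L * bregman g g' x y := h.norm_grad_sub_sq_le x y
    _ ≤ 2 * L * (L / 2 * ‖x - y‖ ^ 2) := by gcongr; exact h.bregman_le x y
    _ = (L * ‖x - y‖) ^ 2 := by ring

theorem hasGradientAt [CompleteSpace E] (h : SmoothConvex L g g') (x : E) :
    HasGradientAt g (g' x) x := by
  have hquad : (fun y => g y - g x - inner ℝ (g' x) (y - x)) =O[𝓝 x] fun y => ‖y - x‖ ^ 2 := by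
    refine .of_bound (L / 2) (.of_forall fun y => ?_)
    rw [Real.norm_of_nonneg (by linarith [h.lower x y]), norm_pow, norm_norm]
    linarith [h.upper x y]
  have hsub : Tendsto (fun y => y - x) (𝓝 x) (𝓝 0) := by
    simpa using (continuous_id.sub continuous_const).tendsto (x := x) (f := fun y : E => y - x)
  exact hasGradientAt_iff_isLittleO.2
    (hquad.trans_isLittleO ((Asymptotics.isLittleO_norm_pow_id one_lt_two).comp_tendsto hsub))

theorem grad_eq_zero [CompleteSpace E] (h : SmoothConvex L g g') {x : E}
    (hx : ∀ y, g x ≤ g y) : g' x = 0 := by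
  have hmin : IsLocalMin g x := .of_forall hx
  simpa using hmin.hasFDerivAt_eq_zero (h.hasGradientAt x).hasFDerivAt

theorem sub_sub_le_inner_grad (h : SmoothConvex L g g') (x y s : E) :
    g y - g s - L / 2 * ‖x - y‖ ^ 2 ≤ inner ℝ (g' x) (y - s) := by
  have hlower := h.lower x s
  have hupper := h.upper x y
  rw [show y - s = (y - x) - (s - x) by abel, inner_sub_right, norm_sub_rev x y]
  linarith

theorem continuous [CompleteSpace E] (h : SmoothConvex L g g') : Continuous g :=
  continuous_iff_continuousAt.2 fun x => (h.hasGradientAt x).continuousAt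

theorem continuous_grad (h : SmoothConvex L g g') : Continuous g' :=
  (LipschitzWith.of_dist_le' fun x y => by
    simpa only [dist_eq_norm] using h.norm_grad_sub_le x y).continuous

end SmoothConvex

variable [CompleteSpace E] {L : ℝ} {g : E → ℝ}

theorem hasDerivAt_comp_line (hg : Differentiable ℝ g) (x y : E) (t : ℝ) :
    HasDerivAt (fun t : ℝ => g (x + t • (y - x)))
      (inner ℝ (gradient g (x + t • (y - x))) (y - x)) t := by
  have hline : HasDerivAt (fun t : ℝ => x + t • (y - x)) (y - x) t := by
    simpa using ((hasDerivAt_id t).smul_const (y - x)).const_add x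
  exact (hg (x + t • (y - x))).hasGradientAt.hasFDerivAt.comp_hasDerivAt t hline

theorem add_inner_gradient_le_of_convexOn (hc : ConvexOn ℝ Set.univ g)
    (hg : Differentiable ℝ g) (x y : E) : g x + inner ℝ (gradient g x) (y - x) ≤ g y := by
  have hconv : ConvexOn ℝ Set.univ (fun t : ℝ => g (x + t • (y - x))) := by
    refine (hc.comp_affineMap (AffineMap.lineMap x y : ℝ →ᵃ[ℝ] E)).congr fun t _ => ?_
    simp [AffineMap.lineMap_apply, add_comm]
  have hslope := hconv.le_slope_of_hasDerivAt (Set.mem_univ 0) (Set.mem_univ 1) zero_lt_one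
    (hasDerivAt_comp_line hg x y 0)
  simp only [slope_def_field, zero_smul, add_zero, one_smul, add_sub_cancel, sub_zero,
    div_one] at hslope
  linarith

theorem le_add_inner_gradient_add_of_lipschitz (hg : Differentiable ℝ g)
    (hL : ∀ x y, ‖gradient g x - gradient g y‖ ≤ L * ‖x - y‖) (x y : E) :
    g y ≤ g x + inner ℝ (gradient g x) (y - x) + L / 2 * ‖y - x‖ ^ 2 := by
  let φ : ℝ → ℝ := fun t => g (x + t • (y - x)) - t * inner ℝ (gradient g x) (y - x)
    - L / 2 * t ^ 2 * ‖y - x‖ ^ 2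
  have hφ : ∀ t, HasDerivAt φ (inner ℝ (gradient g (x + t • (y - x)) - gradient g x) (y - x)
      - L * t * ‖y - x‖ ^ 2) t := fun t => by
    refine (((hasDerivAt_comp_line hg x y t).sub ((hasDerivAt_id t).mul_const
      (inner ℝ (gradient g x) (y - x)))).sub
      ((((hasDerivAt_id t).pow 2).const_mul (L / 2)).mul_const (‖y - x‖ ^ 2))).congr_deriv ?_
    simp only [id, Nat.cast_ofNat, inner_sub_left]
    ring
  have hanti : AntitoneOn φ (Set.Icc 0 1) := by
    refine antitoneOn_of_deriv_nonpos (convex_Icc 0 1)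
      (fun t _ => (hφ t).continuousAt.continuousWithinAt)
      (fun t _ => (hφ t).differentiableAt.differentiableWithinAt) fun t ht => ?_
    rw [interior_Icc] at ht
    have hlip := hL (x + t • (y - x)) x
    rw [add_sub_cancel_left, norm_smul, Real.norm_of_nonneg ht.1.le] at hlip
    rw [(hφ t).deriv]
    calc inner ℝ (gradient g (x + t • (y - x)) - gradient g x) (y - x) - L * t * ‖y - x‖ ^ 2
        ≤ L * (t * ‖y - x‖) * ‖y - x‖ - L * t * ‖y - x‖ ^ 2 := by
          gcongr
          exact (real_inner_le_norm _ _).trans (by gcongr)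
      _ = 0 := by ring
  have hends := hanti (Set.left_mem_Icc.2 zero_le_one) (Set.right_mem_Icc.2 zero_le_one)
    zero_le_one
  simp only [φ, zero_smul, add_zero, one_smul, add_sub_cancel] at hends
  linarith

theorem LSmooth.differentiable {d : ℕ} {g : EuclideanSpace ℝ (Fin d) → ℝ} (h : LSmooth L g) :
    Differentiable ℝ g :=
  h.1.differentiable one_ne_zero

theorem LSmooth.smoothConvex {d : ℕ} {g : EuclideanSpace ℝ (Fin d) → ℝ} (h : LSmooth L g)
    (hL : 0 ≤ L) (hc : ConvexOn ℝ Set.univ g) : SmoothConvex L g (gradient g) where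
  nonneg := hL
  lower := add_inner_gradient_le_of_convexOn hc h.differentiable
  upper := le_add_inner_gradient_add_of_lipschitz h.differentiable h.2

end Convex

/-! ### Second moments -/

theorem norm_add₃_sq_le {E : Type*} [SeminormedAddCommGroup E] (a b c : E) :
    ‖a + b + c‖ ^ 2 ≤ 3 * ‖a‖ ^ 2 + 3 * ‖b‖ ^ 2 + 3 * ‖c‖ ^ 2 := by
  calc ‖a + b + c‖ ^ 2 ≤ (‖a‖ + ‖b‖ + ‖c‖) ^ 2 := by gcongr; exact norm_add₃_le
    _ ≤ 3 * ‖a‖ ^ 2 + 3 * ‖b‖ ^ 2 + 3 * ‖c‖ ^ 2 := by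
      linarith [sq_nonneg (‖a‖ - ‖b‖), sq_nonneg (‖b‖ - ‖c‖), sq_nonneg (‖a‖ - ‖c‖)]

section SecondMoment

variable {Ω : Type*} [MeasurableSpace Ω] {μ : Measure Ω}

theorem integral_add₃ {f g h : Ω → ℝ} (hf : Integrable f μ) (hg : Integrable g μ)
    (hh : Integrable h μ) :
    ∫ ω, f ω + g ω + h ω ∂μ = ∫ ω, f ω ∂μ + ∫ ω, g ω ∂μ + ∫ ω, h ω ∂μ := by
  have hfg : Integrable (fun ω => f ω + g ω) μ := hf.add hg
  rw [integral_add hfg hh, integral_add hf hg]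

variable {E : Type*} [NormedAddCommGroup E]

theorem integrable_norm_sq {f : Ω → E} (hf : MemLp f 2 μ) :
    Integrable (fun ω => ‖f ω‖ ^ 2) μ :=
  hf.integrable_norm_pow two_ne_zero

theorem memLp_two_of_norm_sq_le {f : Ω → E} (hf : AEStronglyMeasurable f μ) {b : Ω → ℝ}
    (hb : Integrable b μ) (h : ∀ᵐ ω ∂μ, ‖f ω‖ ^ 2 ≤ b ω) : MemLp f 2 μ := by
  refine (memLp_two_iff_integrable_sq_norm hf).2 (hb.mono' (hf.norm.pow 2) ?_)
  simpa only [norm_pow, norm_norm] using h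

variable [InnerProductSpace ℝ E]

theorem integrable_inner {f g : Ω → E} (hf : MemLp f 2 μ) (hg : MemLp g 2 μ) :
    Integrable (fun ω => inner ℝ (f ω) (g ω)) μ :=
  (hf.norm.integrable_mul hg.norm).mono' (hf.1.inner hg.1)
    (.of_forall fun ω => norm_inner_le_norm (f ω) (g ω))

theorem integral_norm_add_sq {f g : Ω → E} (hf : MemLp f 2 μ) (hg : MemLp g 2 μ) :
    ∫ ω, ‖f ω + g ω‖ ^ 2 ∂μ
      = ∫ ω, ‖f ω‖ ^ 2 ∂μ + 2 * ∫ ω, inner ℝ (f ω) (g ω) ∂μ + ∫ ω, ‖g ω‖ ^ 2 ∂μ := by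
  simp_rw [norm_add_sq_real]
  rw [integral_add₃ (integrable_norm_sq hf) ((integrable_inner hf hg).const_mul 2)
    (integrable_norm_sq hg), integral_const_mul]

theorem integral_norm_sub_integral_sq_le [CompleteSpace E] [IsProbabilityMeasure μ]
    {f : Ω → E} (hf : MemLp f 2 μ) :
    ∫ ω, ‖f ω - ∫ ω', f ω' ∂μ‖ ^ 2 ∂μ ≤ ∫ ω, ‖f ω‖ ^ 2 ∂μ := by
  have hinner : ∫ ω, inner ℝ (f ω) (-∫ ω', f ω' ∂μ) ∂μ = -‖∫ ω', f ω' ∂μ‖ ^ 2 := by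
    simp_rw [inner_neg_right, fun ω => real_inner_comm (∫ ω', f ω' ∂μ) (f ω)]
    rw [integral_neg, integral_inner (hf.integrable one_le_two), real_inner_self_eq_norm_sq]
  simp_rw [sub_eq_add_neg]
  rw [integral_norm_add_sq hf (memLp_const _), hinner, norm_neg, integral_const, probReal_univ,
    one_smul]
  linarith [sq_nonneg ‖∫ ω', f ω' ∂μ‖]

theorem integral_norm_sum_sq_of_orthogonal {α : Type*} (s : Finset α) {f : α → Ω → E}
    (hf : ∀ a ∈ s, MemLp (f a) 2 μ)
    (h : ∀ a ∈ s, ∀ b ∈ s, a ≠ b → ∫ ω, inner ℝ (f a ω) (f b ω) ∂μ = 0) :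
    ∫ ω, ‖∑ a ∈ s, f a ω‖ ^ 2 ∂μ = ∑ a ∈ s, ∫ ω, ‖f a ω‖ ^ 2 ∂μ := by
  have hint : ∀ a ∈ s, ∀ b ∈ s, Integrable (fun ω => inner ℝ (f a ω) (f b ω)) μ :=
    fun a ha b hb => integrable_inner (hf a ha) (hf b hb)
  simp_rw [← real_inner_self_eq_norm_sq, sum_inner, inner_sum]
  rw [integral_finsetSum _ fun a ha => integrable_finsetSum _ (hint a ha)]
  refine Finset.sum_congr rfl fun a ha => ?_
  rw [integral_finsetSum _ (hint a ha),
    Finset.sum_eq_single_of_mem a ha fun b hb hab => h a ha b hb hab.symm]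

end SecondMoment

section Averages

variable {E : Type*} [NormedAddCommGroup E] [InnerProductSpace ℝ E] {L : ℝ}

theorem SmoothConvex.average {ι : Type*} [Fintype ι] [Nonempty ι] {g : ι → E → ℝ}
    {g' : ι → E → E} (h : ∀ n, SmoothConvex L (g n) (g' n)) :
    SmoothConvex L (fun x => (1 / (Fintype.card ι : ℝ)) * ∑ n, g n x)
      (fun x => (1 / (Fintype.card ι : ℝ)) • ∑ n, g' n x) where
  nonneg := (h (Classical.arbitrary ι)).nonneg
  lower x y := by
    rw [real_inner_smul_left, sum_inner, ← mul_add, ← Finset.sum_add_distrib]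
    gcongr with n
    exact (h n).lower x y
  upper x y := by
    have hquad : L / 2 * ‖y - x‖ ^ 2
        = 1 / (Fintype.card ι : ℝ) * ∑ _n : ι, L / 2 * ‖y - x‖ ^ 2 := by
      rw [Finset.sum_const, Finset.card_univ, nsmul_eq_mul]
      field_simp
    rw [hquad, real_inner_smul_left, sum_inner, ← mul_add, ← mul_add, ← Finset.sum_add_distrib,
      ← Finset.sum_add_distrib]
    gcongr with n
    exact (h n).upper x y

variable {Ξ : Type*} [MeasurableSpace Ξ] {ν : Measure Ξ} {f : E → Ξ → ℝ} {g : E → Ξ → E}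

theorem integrable_bregman {x y : E} (hx : Integrable (f x) ν) (hy : Integrable (f y) ν)
    (hg : Integrable (g y) ν) :
    Integrable (fun z => bregman (fun x => f x z) (fun x => g x z) x y) ν :=
  (hx.sub hy).sub (hg.inner_const _)

variable [CompleteSpace E]

theorem inner_integral_left {v : Ξ → E} (hv : Integrable v ν) (c : E) :
    inner ℝ (∫ z, v z ∂ν) c = ∫ z, inner ℝ (v z) c ∂ν := by
  simp_rw [real_inner_comm c]
  exact (integral_inner hv c).symm

theorem SmoothConvex.integral [IsProbabilityMeasure ν] (hL : 0 ≤ L)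
    (h : ∀ z, SmoothConvex L (fun x => f x z) fun x => g x z)
    (hf : ∀ x, Integrable (f x) ν) (hg : ∀ x, Integrable (g x) ν) :
    SmoothConvex L (fun x => ∫ z, f x z ∂ν) (fun x => ∫ z, g x z ∂ν) where
  nonneg := hL
  lower x y := by
    rw [inner_integral_left (hg x), ← integral_add (hf x) ((hg x).inner_const _)]
    exact integral_mono ((hf x).add ((hg x).inner_const _)) (hf y) fun z => (h z).lower x y
  upper x y := by
    have hquad : L / 2 * ‖y - x‖ ^ 2 = ∫ _z, L / 2 * ‖y - x‖ ^ 2 ∂ν := by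
      rw [integral_const, probReal_univ, one_smul]
    rw [inner_integral_left (hg x), hquad,
      ← integral_add₃ (hf x) ((hg x).inner_const _) (integrable_const _)]
    exact integral_mono (hf y)
      (((hf x).add ((hg x).inner_const _)).add (integrable_const _)) fun z => (h z).upper x y

theorem integral_bregman {x y : E} (hx : Integrable (f x) ν) (hy : Integrable (f y) ν)
    (hg : Integrable (g y) ν) :
    ∫ z, bregman (fun x => f x z) (fun x => g x z) x y ∂ν
      = bregman (fun x => ∫ z, f x z ∂ν) (fun x => ∫ z, g x z ∂ν) x y := by
  have hxy : Integrable (fun z => f x z - f y z) ν := hx.sub hy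
  simp only [bregman]
  rw [integral_sub hxy (hg.inner_const _), integral_sub hx hy, inner_integral_left hg]

theorem measurable_inner_of_hasGradientAt {x : E} {v : Ξ → E} (hf : ∀ y, Measurable (f y))
    (hv : ∀ z, HasGradientAt (fun y => f y z) (v z) x) (e : E) :
    Measurable fun z => inner ℝ (v z) e := by
  refine measurable_of_tendsto_metrizable
    (f := fun (k : ℕ) z => ((k : ℝ) + 1) * (f (x + (1 / ((k : ℝ) + 1)) • e) z - f x z))
    (fun k => ((hf _).sub (hf _)).const_mul _) (tendsto_pi_nhds.2 fun z => ?_)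
  have hsteps : Tendsto (fun k : ℕ => 1 / ((k : ℝ) + 1)) atTop (𝓝[≠] 0) :=
    tendsto_nhdsWithin_iff.2 ⟨tendsto_one_div_add_atTop_nhds_zero_nat,
      .of_forall fun k => (show (0 : ℝ) < 1 / ((k : ℝ) + 1) by positivity).ne'⟩
  have hderiv : HasLineDerivAt ℝ (fun y => f y z) (inner ℝ (v z) e) x e :=
    (hv z).hasFDerivAt.hasLineDerivAt e
  refine (hderiv.tendsto_slope_zero.comp hsteps).congr fun k => ?_
  simp only [Function.comp_apply, one_div, inv_inv, smul_eq_mul]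

end Averages

/-! ### Stochastic gradients -/

section StochasticGradient

variable {ι Ξ : Type*} [MeasurableSpace Ξ] {d : ℕ}

/-- The gradient noise of node `n`: the deviation of its stochastic gradient from the gradient of
its local cost. -/
def gradNoise (𝒟 : ι → Measure Ξ) (F : ι → EuclideanSpace ℝ (Fin d) → Ξ → ℝ) (n : ι)
    (x : EuclideanSpace ℝ (Fin d)) (z : Ξ) : EuclideanSpace ℝ (Fin d) :=
  stochGrad F n x z - gradient (localCost 𝒟 F n) x

/-- The Bregman divergence of the local cost of node `n` from the minimizer `xs`; it is the
measure of progress in which the gradients and the gradient noise are controlled. -/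
abbrev localGap (𝒟 : ι → Measure Ξ) (F : ι → EuclideanSpace ℝ (Fin d) → Ξ → ℝ)
    (xs : EuclideanSpace ℝ (Fin d)) (n : ι) (x : EuclideanSpace ℝ (Fin d)) : ℝ :=
  bregman (localCost 𝒟 F n) (gradient (localCost 𝒟 F n)) x xs

variable [Fintype ι] {𝒟 : ι → Measure Ξ}
  {F : ι → EuclideanSpace ℝ (Fin d) → Ξ → ℝ} {L : ℝ} {xs : EuclideanSpace ℝ (Fin d)}

namespace ConvexCosts

theorem smoothConvex (h : ConvexCosts 𝒟 F L xs) (hL : 0 ≤ L) (n : ι) (z : Ξ) :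
    SmoothConvex L (fun x => F n x z) (fun x => stochGrad F n x z) :=
  (h.smooth n z).smoothConvex hL (h.convex n z)

theorem measurable_stochGrad (h : ConvexCosts 𝒟 F L xs) (n : ι)
    (x : EuclideanSpace ℝ (Fin d)) : Measurable (stochGrad F n x) := by
  have hcoord : ∀ i, Measurable fun z => stochGrad F n x z i := fun i => by
    have hinner := measurable_inner_of_hasGradientAt (v := stochGrad F n x) (h.measurable n)
      (fun z => ((h.smooth n z).differentiable x).hasGradientAt) (EuclideanSpace.single i 1)
    simpa only [EuclideanSpace.inner_single_right, one_mul, conj_trivial] using hinner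
  exact (WithLp.measurable_toLp 2 (Fin d → ℝ)).comp (measurable_pi_iff.2 hcoord)

theorem measurable_uncurry_stochGrad (h : ConvexCosts 𝒟 F L xs) (hL : 0 ≤ L) (n : ι) :
    Measurable fun q : EuclideanSpace ℝ (Fin d) × Ξ => stochGrad F n q.1 q.2 :=
  measurable_uncurry_of_continuous_of_measurable (u := stochGrad F n)
    (fun z => (h.smoothConvex hL n z).continuous_grad) (h.measurable_stochGrad n)

variable [∀ n, IsProbabilityMeasure (𝒟 n)]

theorem memLp_stochGrad (h : ConvexCosts 𝒟 F L xs) (hL : 0 ≤ L) (n : ι)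
    (x : EuclideanSpace ℝ (Fin d)) : MemLp (stochGrad F n x) 2 (𝒟 n) := by
  have hnoise : MemLp (fun z => stochGrad F n xs z - gradient (localCost 𝒟 F n) xs) 2 (𝒟 n) :=
    (memLp_two_iff_integrable_sq_norm
      ((h.measurable_stochGrad n xs).sub_const _).aestronglyMeasurable).2 (h.finite_noise n)
  have hdiff : MemLp (fun z => stochGrad F n x z - stochGrad F n xs z) 2 (𝒟 n) :=
    .of_bound ((h.measurable_stochGrad n x).sub (h.measurable_stochGrad n xs)).aestronglyMeasurable
      (L * ‖x - xs‖) (.of_forall fun z => (h.smoothConvex hL n z).norm_grad_sub_le x xs)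
  refine ((hnoise.add hdiff).add (memLp_const (gradient (localCost 𝒟 F n) xs))).ae_eq
    (.of_forall fun z => ?_)
  simp only [Pi.add_apply]
  abel

theorem integrable_stochGrad (h : ConvexCosts 𝒟 F L xs) (hL : 0 ≤ L) (n : ι)
    (x : EuclideanSpace ℝ (Fin d)) : Integrable (stochGrad F n x) (𝒟 n) :=
  (h.memLp_stochGrad hL n x).integrable one_le_two

theorem smoothConvex_integral_stochGrad (h : ConvexCosts 𝒟 F L xs) (hL : 0 ≤ L) (n : ι) :
    SmoothConvex L (localCost 𝒟 F n) (fun x => ∫ z, stochGrad F n x z ∂(𝒟 n)) :=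
  .integral hL (h.smoothConvex hL n) (h.integrable n) (h.integrable_stochGrad hL n)

theorem gradient_localCost (h : ConvexCosts 𝒟 F L xs) (hL : 0 ≤ L) (n : ι) :
    gradient (localCost 𝒟 F n) = fun x => ∫ z, stochGrad F n x z ∂(𝒟 n) :=
  gradient_eq (h.smoothConvex_integral_stochGrad hL n).hasGradientAt

theorem smoothConvex_localCost (h : ConvexCosts 𝒟 F L xs) (hL : 0 ≤ L) (n : ι) :
    SmoothConvex L (localCost 𝒟 F n) (gradient (localCost 𝒟 F n)) := by
  rw [h.gradient_localCost hL n]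
  exact h.smoothConvex_integral_stochGrad hL n

theorem localGap_nonneg (h : ConvexCosts 𝒟 F L xs) (hL : 0 ≤ L) (n : ι)
    (x : EuclideanSpace ℝ (Fin d)) : 0 ≤ localGap 𝒟 F xs n x :=
  (h.smoothConvex_localCost hL n).bregman_nonneg x xs

theorem smoothConvex_globalCost [Nonempty ι] (h : ConvexCosts 𝒟 F L xs) (hL : 0 ≤ L) :
    SmoothConvex L (globalCost 𝒟 F)
      (fun x => (1 / (Fintype.card ι : ℝ)) • ∑ n, gradient (localCost 𝒟 F n) x) :=
  .average (h.smoothConvex_localCost hL)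

theorem sum_gradient_eq_zero [Nonempty ι] (h : ConvexCosts 𝒟 F L xs) (hL : 0 ≤ L) :
    ∑ n, gradient (localCost 𝒟 F n) xs = 0 :=
  (smul_eq_zero.1 ((h.smoothConvex_globalCost hL).grad_eq_zero h.minimizer)).resolve_left
    (one_div_ne_zero (Nat.cast_ne_zero.2 Fintype.card_ne_zero))

theorem sum_localGap [Nonempty ι] (h : ConvexCosts 𝒟 F L xs) (hL : 0 ≤ L)
    (x : EuclideanSpace ℝ (Fin d)) :
    ∑ n, localGap 𝒟 F xs n x = Fintype.card ι * (globalCost 𝒟 F x - globalCost 𝒟 F xs) := by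
  simp only [localGap, bregman, Finset.sum_sub_distrib, ← sum_inner, h.sum_gradient_eq_zero hL,
    globalCost, inner_zero_left]
  field_simp
  ring

theorem norm_gradient_sq_le (h : ConvexCosts 𝒟 F L xs) (hL : 0 ≤ L) (n : ι)
    (x y : EuclideanSpace ℝ (Fin d)) :
    ‖gradient (localCost 𝒟 F n) x‖ ^ 2 ≤ 3 * L ^ 2 * ‖x - y‖ ^ 2
      + 6 * L * localGap 𝒟 F xs n y + 3 * ‖gradient (localCost 𝒟 F n) xs‖ ^ 2 := by
  have hs := h.smoothConvex_localCost hL n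
  have hsplit := norm_add₃_sq_le (gradient (localCost 𝒟 F n) x - gradient (localCost 𝒟 F n) y)
    (gradient (localCost 𝒟 F n) y - gradient (localCost 𝒟 F n) xs)
    (gradient (localCost 𝒟 F n) xs)
  rw [sub_add_sub_cancel, sub_add_cancel] at hsplit
  have hlip := pow_le_pow_left₀ (norm_nonneg _) (hs.norm_grad_sub_le x y) 2
  have hcoc := hs.norm_grad_sub_sq_le y xs
  linarith

theorem measurable_gradNoise (h : ConvexCosts 𝒟 F L xs) (hL : 0 ≤ L) (n : ι) :
    Measurable fun q : EuclideanSpace ℝ (Fin d) × Ξ => gradNoise 𝒟 F n q.1 q.2 :=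
  (h.measurable_uncurry_stochGrad hL n).sub
    ((h.smoothConvex_localCost hL n).continuous_grad.measurable.comp measurable_fst)

theorem memLp_gradNoise (h : ConvexCosts 𝒟 F L xs) (hL : 0 ≤ L) (n : ι)
    (x : EuclideanSpace ℝ (Fin d)) : MemLp (gradNoise 𝒟 F n x) 2 (𝒟 n) :=
  (h.memLp_stochGrad hL n x).sub (memLp_const _)

theorem integral_gradNoise (h : ConvexCosts 𝒟 F L xs) (hL : 0 ≤ L) (n : ι)
    (x : EuclideanSpace ℝ (Fin d)) : ∫ z, gradNoise 𝒟 F n x z ∂(𝒟 n) = 0 := by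
  simp only [gradNoise]
  rw [integral_sub (h.integrable_stochGrad hL n x) (integrable_const _), h.gradient_localCost hL,
    integral_const, probReal_univ, one_smul, sub_self]

theorem integral_stochGrad_sub_sq_le_bregman (h : ConvexCosts 𝒟 F L xs) (hL : 0 ≤ L) (n : ι)
    (x y : EuclideanSpace ℝ (Fin d)) :
    ∫ z, ‖stochGrad F n x z - stochGrad F n y z‖ ^ 2 ∂(𝒟 n)
      ≤ 2 * L * bregman (localCost 𝒟 F n) (gradient (localCost 𝒟 F n)) x y := by
  have hx := h.integrable n x
  have hy := h.integrable n y
  have hg := h.integrable_stochGrad hL n y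
  have hmean := integral_bregman hx hy hg
  rw [h.gradient_localCost hL]
  refine (integral_mono
    (integrable_norm_sq ((h.memLp_stochGrad hL n x).sub (h.memLp_stochGrad hL n y)))
    ((integrable_bregman hx hy hg).const_mul (2 * L))
    fun z => (h.smoothConvex hL n z).norm_grad_sub_sq_le x y).trans_eq ?_
  rw [integral_const_mul, hmean]
  rfl

theorem integral_stochGrad_sub_sq_le_norm (h : ConvexCosts 𝒟 F L xs) (hL : 0 ≤ L) (n : ι)
    (x y : EuclideanSpace ℝ (Fin d)) :
    ∫ z, ‖stochGrad F n x z - stochGrad F n y z‖ ^ 2 ∂(𝒟 n) ≤ L ^ 2 * ‖x - y‖ ^ 2 := by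
  refine (integral_mono
    (integrable_norm_sq ((h.memLp_stochGrad hL n x).sub (h.memLp_stochGrad hL n y)))
    (integrable_const ((L * ‖x - y‖) ^ 2)) fun z => pow_le_pow_left₀ (norm_nonneg _)
      ((h.smoothConvex hL n z).norm_grad_sub_le x y) 2).trans_eq ?_
  rw [integral_const, probReal_univ, one_smul, mul_pow]

theorem integral_gradNoise_sub_sq_le (h : ConvexCosts 𝒟 F L xs) (hL : 0 ≤ L) (n : ι)
    (x y : EuclideanSpace ℝ (Fin d)) :
    ∫ z, ‖gradNoise 𝒟 F n x z - gradNoise 𝒟 F n y z‖ ^ 2 ∂(𝒟 n)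
      ≤ ∫ z, ‖stochGrad F n x z - stochGrad F n y z‖ ^ 2 ∂(𝒟 n) := by
  have hx := h.memLp_stochGrad hL n x
  have hy := h.memLp_stochGrad hL n y
  refine le_of_eq_of_le ?_ (integral_norm_sub_integral_sq_le (hx.sub hy))
  simp only [gradNoise, h.gradient_localCost hL,
    integral_sub (hx.integrable one_le_two) (hy.integrable one_le_two), sub_sub_sub_comm]

theorem integral_gradNoise_sq_le (h : ConvexCosts 𝒟 F L xs) (hL : 0 ≤ L) (n : ι)
    (x y : EuclideanSpace ℝ (Fin d)) :
    ∫ z, ‖gradNoise 𝒟 F n x z‖ ^ 2 ∂(𝒟 n) ≤ 3 * L ^ 2 * ‖x - y‖ ^ 2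
      + 6 * L * localGap 𝒟 F xs n y + 3 * noiseSq 𝒟 F xs n := by
  have hnoise := h.memLp_gradNoise hL n
  have hint_xy := (integrable_norm_sq ((hnoise x).sub (hnoise y))).const_mul 3
  have hint_ys := (integrable_norm_sq ((hnoise y).sub (hnoise xs))).const_mul 3
  have hint_s := (integrable_norm_sq (hnoise xs)).const_mul 3
  simp only [Pi.sub_apply] at hint_xy hint_ys
  have hsplit := integral_mono (integrable_norm_sq (hnoise x))
      ((hint_xy.add hint_ys).add hint_s) fun z => by
    have := norm_add₃_sq_le (gradNoise 𝒟 F n x z - gradNoise 𝒟 F n y z)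
      (gradNoise 𝒟 F n y z - gradNoise 𝒟 F n xs z) (gradNoise 𝒟 F n xs z)
    rwa [sub_add_sub_cancel, sub_add_cancel] at this
  simp only [Pi.add_apply] at hsplit
  rw [integral_add₃ hint_xy hint_ys hint_s, integral_const_mul, integral_const_mul,
    integral_const_mul] at hsplit
  have hxy := (h.integral_gradNoise_sub_sq_le hL n x y).trans
    (h.integral_stochGrad_sub_sq_le_norm hL n x y)
  have hys := (h.integral_gradNoise_sub_sq_le hL n y xs).trans
    (h.integral_stochGrad_sub_sq_le_bregman hL n y xs)
  have hs : ∫ z, ‖gradNoise 𝒟 F n xs z‖ ^ 2 ∂(𝒟 n) = noiseSq 𝒟 F xs n := rfl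
  linarith

end ConvexCosts

end StochasticGradient

/-! ### Independence -/

section Independence

theorem iSup_comap_le_comap_pi {Ω α : Type*} {β : α → Type*} [∀ a, MeasurableSpace (β a)]
    (f : ∀ a, Ω → β a) :
    (⨆ a, MeasurableSpace.comap (f a) inferInstance)
      ≤ MeasurableSpace.comap (fun ω a => f a ω) inferInstance := by
  refine iSup_le fun a => ?_
  rintro s ⟨t, ht, rfl⟩
  exact ⟨(fun g => g a) ⁻¹' t, measurable_pi_apply a ht, rfl⟩

variable {Ω : Type*} [mΩ : MeasurableSpace Ω] {μ : Measure Ω}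

theorem iIndep_sumElim {α β : Type*} {m₁ : α → MeasurableSpace Ω} {m₂ : β → MeasurableSpace Ω}
    (h₁ : iIndep m₁ μ) (h₂ : iIndep m₂ μ) (h : Indep (⨆ a, m₁ a) (⨆ b, m₂ b) μ) :
    iIndep (Sum.elim m₁ m₂) μ := by
  rw [iIndep_iff] at h₁ h₂ ⊢
  intro s f hf
  have hinter : (⋂ i ∈ s, f i)
      = (⋂ a ∈ s.toLeft, f (.inl a)) ∩ ⋂ b ∈ s.toRight, f (.inr b) := by
    ext ω
    simp
  have hl : ∀ a ∈ s.toLeft, MeasurableSet[m₁ a] (f (.inl a)) :=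
    fun a ha => hf (.inl a) (Finset.mem_toLeft.1 ha)
  have hr : ∀ b ∈ s.toRight, MeasurableSet[m₂ b] (f (.inr b)) :=
    fun b hb => hf (.inr b) (Finset.mem_toRight.1 hb)
  rw [hinter, (Indep_iff _ _ _).1 h _ _
    (Finset.measurableSet_biInter _ fun a ha => le_iSup m₁ a _ (hl a ha))
    (Finset.measurableSet_biInter _ fun b hb => le_iSup m₂ b _ (hr b hb)),
    h₁ _ hl, h₂ _ hr]
  conv_rhs => rw [← s.toLeft_disjSum_toRight, Finset.prod_disjSum]

variable {α β : Type*} [MeasurableSpace α] [MeasurableSpace β] {U : Ω → α} {V : Ω → β}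

theorem indepFun_of_indep {m₁ m₂ : MeasurableSpace Ω} (h : Indep m₁ m₂ μ)
    (hU : Measurable[m₁] U) (hV : Measurable[m₂] V) : IndepFun U V μ :=
  indep_of_indep_of_le_left (indep_of_indep_of_le_right h hV.comap_le) hU.comap_le

variable [IsFiniteMeasure μ]

theorem integral_eq_zero_of_indepFun (hU : Measurable U) (hV : Measurable V)
    (hUV : IndepFun U V μ) {h : α × β → ℝ} (hh : Measurable h)
    (hint : Integrable (fun ω => h (U ω, V ω)) μ)
    (h0 : ∀ u, ∫ v, h (u, v) ∂(μ.map V) = 0) : ∫ ω, h (U ω, V ω) ∂μ = 0 := by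
  have hmap := (indepFun_iff_map_prod_eq_prod_map_map hU.aemeasurable hV.aemeasurable).1 hUV
  have hpair : Measurable fun ω => (U ω, V ω) := hU.prodMk hV
  have hint' : Integrable h ((μ.map U).prod (μ.map V)) := by
    rw [← hmap]
    exact (integrable_map_measure hh.aestronglyMeasurable hpair.aemeasurable).2 hint
  rw [← integral_map (μ := μ) hpair.aemeasurable hh.aestronglyMeasurable, hmap,
    integral_prod _ hint']
  simp only [h0, integral_zero]

theorem integral_le_of_indepFun (hU : Measurable U) (hV : Measurable V)
    (hUV : IndepFun U V μ) {h : α × β → ℝ} (hh : Measurable h) (hnonneg : ∀ q, 0 ≤ h q)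
    {b : α → ℝ} (hb : Integrable (fun ω => b (U ω)) μ) (hbm : Measurable b)
    (hint : ∀ u, Integrable (fun v => h (u, v)) (μ.map V))
    (hle : ∀ u, ∫ v, h (u, v) ∂(μ.map V) ≤ b u) :
    Integrable (fun ω => h (U ω, V ω)) μ ∧ ∫ ω, h (U ω, V ω) ∂μ ≤ ∫ ω, b (U ω) ∂μ := by
  have hmap := (indepFun_iff_map_prod_eq_prod_map_map hU.aemeasurable hV.aemeasurable).1 hUV
  have hpair : Measurable fun ω => (U ω, V ω) := hU.prodMk hV
  have hbU : Integrable b (μ.map U) :=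
    (integrable_map_measure hbm.aestronglyMeasurable hU.aemeasurable).2 hb
  have hprod : Integrable h ((μ.map U).prod (μ.map V)) := by
    rw [integrable_prod_iff hh.aestronglyMeasurable]
    refine ⟨.of_forall hint, ?_⟩
    simp_rw [Real.norm_of_nonneg (hnonneg _)]
    refine hbU.mono' hh.stronglyMeasurable.integral_prod_right'.aestronglyMeasurable
      (.of_forall fun u => ?_)
    rw [Real.norm_of_nonneg (integral_nonneg fun v => hnonneg _)]
    exact hle u
  refine ⟨(integrable_map_measure hh.aestronglyMeasurable hpair.aemeasurable).1
    (hmap ▸ hprod), ?_⟩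
  rw [← integral_map (μ := μ) hpair.aemeasurable hh.aestronglyMeasurable, hmap,
    integral_prod _ hprod, ← integral_map hU.aemeasurable hbm.aestronglyMeasurable]
  exact integral_mono hprod.integral_prod_left hbU hle

end Independence

section NoiseAtRandomPoint

variable {Ω ι Ξ : Type*} {m : MeasurableSpace Ω} [mΩ : MeasurableSpace Ω] [MeasurableSpace Ξ]
  [Fintype ι] {μ : Measure Ω} {d : ℕ} {𝒟 : ι → Measure Ξ} [∀ n, IsProbabilityMeasure (𝒟 n)]
  {F : ι → EuclideanSpace ℝ (Fin d) → Ξ → ℝ} {L : ℝ} {xs : EuclideanSpace ℝ (Fin d)}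
  {V : Ω → Ξ} {x : Ω → EuclideanSpace ℝ (Fin d)} {n : ι}

namespace ConvexCosts

theorem integral_inner_gradNoise [IsFiniteMeasure μ] (h : ConvexCosts 𝒟 F L xs) (hL : 0 ≤ L)
    (hm : m ≤ mΩ) (hV : Measurable V) (hlaw : μ.map V = 𝒟 n)
    (hind : Indep m (MeasurableSpace.comap V inferInstance) μ) (hx : Measurable[m] x)
    {Z : Ω → EuclideanSpace ℝ (Fin d)} (hZ : Measurable[m] Z)
    (hint : Integrable (fun ω => inner ℝ (Z ω) (gradNoise 𝒟 F n (x ω) (V ω))) μ) :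
    ∫ ω, inner ℝ (Z ω) (gradNoise 𝒟 F n (x ω) (V ω)) ∂μ = 0 := by
  have hU : Measurable[m] fun ω => (x ω, Z ω) := hx.prodMk hZ
  refine integral_eq_zero_of_indepFun (hU.mono hm le_rfl) hV
    (indepFun_of_indep hind hU (comap_measurable V))
    (h := fun q => inner ℝ q.1.2 (gradNoise 𝒟 F n q.1.1 q.2)) ?_ hint fun u => ?_
  · exact (measurable_snd.comp measurable_fst).inner ((h.measurable_gradNoise hL n).comp
      ((measurable_fst.comp measurable_fst).prodMk measurable_snd))
  · rw [hlaw]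
    refine (integral_inner ((h.memLp_gradNoise hL n u.1).integrable one_le_two) u.2).trans ?_
    rw [h.integral_gradNoise hL, inner_zero_right]

theorem integral_gradNoise_comp_sq_le [IsProbabilityMeasure μ] (h : ConvexCosts 𝒟 F L xs)
    (hL : 0 ≤ L) (hm : m ≤ mΩ) (hV : Measurable V) (hlaw : μ.map V = 𝒟 n)
    (hind : Indep m (MeasurableSpace.comap V inferInstance) μ) (hx : Measurable[m] x)
    {y : Ω → EuclideanSpace ℝ (Fin d)} (hy : Measurable[m] y)
    (hxy : Integrable (fun ω => ‖x ω - y ω‖ ^ 2) μ)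
    (hgap : Integrable (fun ω => localGap 𝒟 F xs n (y ω)) μ) :
    MemLp (fun ω => gradNoise 𝒟 F n (x ω) (V ω)) 2 μ ∧
    ∫ ω, ‖gradNoise 𝒟 F n (x ω) (V ω)‖ ^ 2 ∂μ ≤ 3 * L ^ 2 * ∫ ω, ‖x ω - y ω‖ ^ 2 ∂μ
      + 6 * L * ∫ ω, localGap 𝒟 F xs n (y ω) ∂μ + 3 * noiseSq 𝒟 F xs n := by
  have hU : Measurable[m] fun ω => (x ω, y ω) := hx.prodMk hy
  have hmeas := h.measurable_gradNoise hL n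
  have hcont := (h.smoothConvex_localCost hL n).continuous
  have hbcont : Continuous fun u : EuclideanSpace ℝ (Fin d) × EuclideanSpace ℝ (Fin d) =>
      3 * L ^ 2 * ‖u.1 - u.2‖ ^ 2 + 6 * L * localGap 𝒟 F xs n u.2 + 3 * noiseSq 𝒟 F xs n := by
    unfold localGap bregman
    fun_prop
  have hxy' := hxy.const_mul (3 * L ^ 2)
  have hgap' := hgap.const_mul (6 * L)
  obtain ⟨hint, hle⟩ := integral_le_of_indepFun (μ := μ) (hU.mono hm le_rfl) hV
    (indepFun_of_indep hind hU (comap_measurable V))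
    (h := fun q => ‖gradNoise 𝒟 F n q.1.1 q.2‖ ^ 2)
    ((hmeas.comp ((measurable_fst.comp measurable_fst).prodMk measurable_snd)).norm.pow_const 2)
    (fun q => sq_nonneg _) ((hxy'.add hgap').add (integrable_const _)) hbcont.measurable
    (fun u => hlaw ▸ integrable_norm_sq (h.memLp_gradNoise hL n u.1))
    (fun u => hlaw ▸ h.integral_gradNoise_sq_le hL n u.1 u.2)
  refine ⟨(memLp_two_iff_integrable_sq_norm
    (hmeas.comp ((hx.mono hm le_rfl).prodMk hV)).aestronglyMeasurable).2 hint,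
    hle.trans_eq ?_⟩
  rw [integral_add₃ hxy' hgap' (integrable_const _), integral_const_mul, integral_const_mul,
    integral_const, probReal_univ, one_smul]

end ConvexCosts

end NoiseAtRandomPoint

/-! ### Matrices acting on stacked states -/

section Action

/-- The stacked states of the nodes, with the `ℓ²` norm. -/
abbrev Stack (V E : Type*) := PiLp 2 fun _ : V => E

section StackMeasurability

variable {V E Ω : Type*} [MeasurableSpace E] {m : MeasurableSpace Ω}

theorem measurable_toLp {x : Ω → V → E} (hx : ∀ i, Measurable fun ω => x ω i) :
    Measurable fun ω => (WithLp.toLp 2 (x ω) : Stack V E) :=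
  (WithLp.measurable_toLp 2 _).comp (measurable_pi_iff.2 hx)

theorem measurable_stack_apply {X : Ω → Stack V E} (hX : Measurable X) (i : V) :
    Measurable fun ω => X ω i :=
  (measurable_pi_apply i).comp ((WithLp.measurable_ofLp 2 _).comp hX)

end StackMeasurability

variable {V E : Type*} [Fintype V] [NormedAddCommGroup E] [InnerProductSpace ℝ E]

/-- The action of a matrix on stacked states, that is `A ⊗ 1`. -/
def act (A : Matrix V V ℝ) : Stack V E →ₗ[ℝ] Stack V E where
  toFun Z := WithLp.toLp 2 fun i => ∑ j, A i j • Z j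
  map_add' X Y := by
    ext1 i
    simp only [PiLp.add_apply, smul_add, Finset.sum_add_distrib]
  map_smul' c X := by
    ext1 i
    simp only [PiLp.smul_apply, Finset.smul_sum, RingHom.id_apply, smul_comm c]

@[simp] theorem act_apply (A : Matrix V V ℝ) (Z : Stack V E) (i : V) :
    act A Z i = ∑ j, A i j • Z j := rfl

theorem act_sub_matrix (A B : Matrix V V ℝ) (Z : Stack V E) :
    act (A - B) Z = act A Z - act B Z := by
  ext1 i
  simp only [act_apply, PiLp.sub_apply, Matrix.sub_apply, sub_smul, Finset.sum_sub_distrib]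

theorem act_mul (A B : Matrix V V ℝ) (Z : Stack V E) : act (A * B) Z = act A (act B Z) := by
  ext1 i
  simp only [act_apply, Matrix.mul_apply, Finset.sum_smul, Finset.smul_sum, smul_smul]
  exact Finset.sum_comm

theorem act_one [DecidableEq V] (Z : Stack V E) : act 1 Z = Z := by
  ext1 i
  simp only [act_apply, Matrix.one_apply, ite_smul, one_smul, zero_smul, Finset.sum_ite_eq,
    Finset.mem_univ, if_true]

theorem norm_act_le [FiniteDimensional ℝ E] [DecidableEq V] (A : Matrix V V ℝ)
    (Z : Stack V E) : ‖act A Z‖ ≤ specNorm A * ‖Z‖ := by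
  let b := stdOrthonormalBasis ℝ E
  let slice (Y : Stack V E) (c) : EuclideanSpace ℝ V := WithLp.toLp 2 fun i => inner ℝ (b c) (Y i)
  have hslice : ∀ Y : Stack V E, ‖Y‖ ^ 2 = ∑ c, ‖slice Y c‖ ^ 2 := fun Y => by
    simp_rw [PiLp.norm_sq_eq_of_L2, ← b.sum_sq_norm_inner_right]
    exact Finset.sum_comm
  have hact : ∀ c, slice (act A Z) c = Matrix.toEuclideanCLM (n := V) (𝕜 := ℝ) A (slice Z c) :=
    fun c => by
      ext i
      simp [slice, Matrix.mulVec, dotProduct, inner_sum, real_inner_smul_right]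
  have hA : 0 ≤ specNorm A := norm_nonneg _
  refine (pow_le_pow_iff_left₀ (norm_nonneg _) (by positivity) two_ne_zero).1 ?_
  rw [mul_pow, hslice, hslice Z, Finset.mul_sum]
  refine Finset.sum_le_sum fun c _ => ?_
  rw [← mul_pow, hact]
  exact pow_le_pow_left₀ (norm_nonneg _) (ContinuousLinearMap.le_opNorm _ _) 2

theorem measurable_specNorm {Ω : Type*} {m : MeasurableSpace Ω} [DecidableEq V]
    {A : Ω → Matrix V V ℝ} (hA : ∀ i j, Measurable fun ω => A ω i j) :
    Measurable fun ω => specNorm (A ω) := by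
  let T : (V → V → ℝ) →ₗ[ℝ] (EuclideanSpace ℝ V →L[ℝ] EuclideanSpace ℝ V) :=
    (Matrix.toEuclideanCLM (n := V) (𝕜 := ℝ)).toAlgEquiv.toLinearMap ∘ₗ
      (Matrix.ofLinearEquiv ℝ).toLinearMap
  have hentries : Measurable fun ω => (fun i j => A ω i j : V → V → ℝ) :=
    measurable_pi_iff.2 fun i => measurable_pi_iff.2 fun j => hA i j
  exact T.continuous_of_finiteDimensional.norm.measurable.comp hentries

theorem specNorm_mul_le [DecidableEq V] (A B : Matrix V V ℝ) :
    specNorm (A * B) ≤ specNorm A * specNorm B := by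
  simp only [specNorm, map_mul]
  exact norm_mul_le _ _

theorem specNorm_add_le [DecidableEq V] (A B : Matrix V V ℝ) :
    specNorm (A + B) ≤ specNorm A + specNorm B := by
  simp only [specNorm, map_add]
  exact norm_add_le _ _

section Measurability

variable [MeasurableSpace E] [BorelSpace E] [SecondCountableTopology E] {Ω : Type*}
  {m : MeasurableSpace Ω}

theorem measurable_act {A : Ω → Matrix V V ℝ} {Z : Ω → Stack V E}
    (hA : ∀ i j, Measurable fun ω => A ω i j) (hZ : Measurable Z) :
    Measurable fun ω => act (A ω) (Z ω) :=
  measurable_toLp fun i =>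
    Finset.measurable_sum _ fun j _ => (hA i j).smul (measurable_stack_apply hZ j)

theorem memLp_act_of_indep [FiniteDimensional ℝ E] [DecidableEq V] {m₁ m₂ : MeasurableSpace Ω}
    [mΩ : MeasurableSpace Ω] {μ : Measure Ω} (h₁ : m₁ ≤ mΩ) (h₂ : m₂ ≤ mΩ) (hind : Indep m₁ m₂ μ)
    {A : Ω → Matrix V V ℝ} {Z : Ω → Stack V E}
    (hA : ∀ i j, Measurable[m₁] fun ω => A ω i j) (hZ : Measurable[m₂] Z)
    (hAi : Integrable (fun ω => specNorm (A ω) ^ 2) μ) (hZi : MemLp Z 2 μ) :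
    MemLp (fun ω => act (A ω) (Z ω)) 2 μ ∧ ∫ ω, ‖act (A ω) (Z ω)‖ ^ 2 ∂μ
      ≤ (∫ ω, specNorm (A ω) ^ 2 ∂μ) * ∫ ω, ‖Z ω‖ ^ 2 ∂μ := by
  have hindep : IndepFun (fun ω => specNorm (A ω) ^ 2) (fun ω => ‖Z ω‖ ^ 2) μ :=
    indepFun_of_indep hind ((measurable_specNorm hA).pow_const 2)
      ((measurable_norm.pow_const 2).comp hZ)
  have hint : Integrable (fun ω => specNorm (A ω) ^ 2 * ‖Z ω‖ ^ 2) μ :=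
    hindep.integrable_mul hAi (integrable_norm_sq hZi)
  have hle : ∀ ω, ‖act (A ω) (Z ω)‖ ^ 2 ≤ specNorm (A ω) ^ 2 * ‖Z ω‖ ^ 2 := fun ω => by
    rw [← mul_pow]
    exact pow_le_pow_left₀ (norm_nonneg _) (norm_act_le _ _) 2
  have hmem := memLp_two_of_norm_sq_le (measurable_act (fun i j => (hA i j).mono h₁ le_rfl)
    (hZ.mono h₂ le_rfl)).aestronglyMeasurable hint (.of_forall hle)
  refine ⟨hmem, ?_⟩
  rw [← hindep.integral_fun_mul_eq_mul_integral hAi.1 (integrable_norm_sq hZi).1]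
  exact integral_mono (integrable_norm_sq hmem) hint hle

end Measurability

end Action

/-! ### The flow of information -/

section Information

variable {ι κ Ω Ξ : Type*} [MeasurableSpace Ξ]

/-- The information in the weight matrix of a round (`Sum.inl`), or in one sample (`Sum.inr`). -/
@[reducible]
def info (W : ℕ → Ω → Matrix (ι ⊕ κ) (ι ⊕ κ) ℝ) (ξ : ℕ → ι → Ω → Ξ) :
    ℕ ⊕ ℕ × ι → MeasurableSpace Ω :=
  Sum.elim
    (fun k => MeasurableSpace.comap (fun ω (i j : ι ⊕ κ) => W k ω i j) inferInstance)
    (fun q => MeasurableSpace.comap (ξ q.1 q.2) inferInstance)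

/-- The information in a set of weight matrices and samples. Disjoint sets carry independent
information. -/
@[reducible]
def infoOn (W : ℕ → Ω → Matrix (ι ⊕ κ) (ι ⊕ κ) ℝ) (ξ : ℕ → ι → Ω → Ξ)
    (S : Set (ℕ ⊕ ℕ × ι)) : MeasurableSpace Ω :=
  ⨆ i ∈ S, info W ξ i

variable {W : ℕ → Ω → Matrix (ι ⊕ κ) (ι ⊕ κ) ℝ} {ξ : ℕ → ι → Ω → Ξ} {S : Set (ℕ ⊕ ℕ × ι)}

theorem info_le_infoOn {i : ℕ ⊕ ℕ × ι} (hi : i ∈ S) : info W ξ i ≤ infoOn W ξ S :=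
  le_iSup₂ (f := fun i _ => info W ξ i) i hi

theorem measurable_weight_infoOn {k : ℕ} (hk : .inl k ∈ S) (i j : ι ⊕ κ) :
    Measurable[infoOn W ξ S] fun ω => W k ω i j := by
  have h : Measurable[info W ξ (.inl k)] fun ω (i j : ι ⊕ κ) => W k ω i j := comap_measurable _
  exact (((measurable_pi_apply j).comp (measurable_pi_apply i)).comp h).mono
    (info_le_infoOn hk) le_rfl

theorem measurable_sample_infoOn {k : ℕ} {n : ι} (hk : .inr (k, n) ∈ S) :
    Measurable[infoOn W ξ S] (ξ k n) := by
  have h : Measurable[info W ξ (.inr (k, n))] (ξ k n) := comap_measurable _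
  exact h.mono (info_le_infoOn hk) le_rfl

variable [mΩ : MeasurableSpace Ω] {μ : Measure Ω} {𝒟 : ι → Measure Ξ}

namespace RandomModel

theorem info_le (h : RandomModel μ W 𝒟 ξ) (i : ℕ ⊕ ℕ × ι) : info W ξ i ≤ mΩ := by
  rcases i with k | q
  · exact (measurable_pi_iff.2 fun i => measurable_pi_iff.2 fun j =>
      h.measurable_weight k i j).comap_le
  · exact (h.measurable_sample q.1 q.2).comap_le

theorem infoOn_le (h : RandomModel μ W 𝒟 ξ) (S : Set (ℕ ⊕ ℕ × ι)) : infoOn W ξ S ≤ mΩ :=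
  iSup₂_le fun i _ => h.info_le i

theorem iIndep_info (h : RandomModel μ W 𝒟 ξ) : iIndep (info W ξ) μ :=
  iIndep_sumElim h.indep_weight h.indep_sample
    (indep_of_indep_of_le_left (indep_of_indep_of_le_right h.indep
      (iSup_comap_le_comap_pi fun i : ℕ × ι => ξ i.1 i.2))
      (iSup_comap_le_comap_pi fun k ω (i j : ι ⊕ κ) => W k ω i j))

theorem indep_infoOn (h : RandomModel μ W 𝒟 ξ) {S T : Set (ℕ ⊕ ℕ × ι)} (hST : Disjoint S T) :
    Indep (infoOn W ξ S) (infoOn W ξ T) μ :=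
  indep_iSup_of_disjoint h.info_le h.iIndep_info hST

theorem indep_infoOn_compl_sample (h : RandomModel μ W 𝒟 ξ) (k : ℕ) (n : ι) :
    Indep (infoOn W ξ {.inr (k, n)}ᶜ) (MeasurableSpace.comap (ξ k n) inferInstance) μ :=
  indep_of_indep_of_le_right (h.indep_infoOn disjoint_compl_left)
    (info_le_infoOn (W := W) (ξ := ξ) (i := .inr (k, n)) (Set.mem_singleton _))

end RandomModel

end Information

/-! ### Recursions for the average and for the deviations from it -/

section Embed

variable {ι κ E : Type*}

/-- The stack that holds `g n` at the real nodes and `0` at the virtual ones. -/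
def embed (κ : Type*) [Zero E] (g : ι → E) : Stack (ι ⊕ κ) E :=
  WithLp.toLp 2 (Sum.elim g 0)

@[simp] theorem embed_inl [Zero E] (g : ι → E) (n : ι) : embed κ g (.inl n) = g n := rfl

@[simp] theorem embed_inr [Zero E] (g : ι → E) (v : κ) : embed κ g (.inr v) = 0 := rfl

theorem measurable_embed [Zero E] [MeasurableSpace E] {Ω : Type*} {_ : MeasurableSpace Ω}
    {g : Ω → ι → E} (hg : ∀ n, Measurable fun ω => g ω n) :
    Measurable fun ω => embed κ (g ω) :=
  measurable_toLp fun i => i.casesOn hg fun _ => measurable_const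

variable [NormedAddCommGroup E]

theorem embed_add (g h : ι → E) : embed κ (g + h) = embed κ g + embed κ h := by
  ext1 i
  rcases i with n | v <;> simp

variable [Fintype ι]

theorem embed_eq_sum [DecidableEq ι] (g : ι → E) :
    embed κ g = ∑ n, embed κ (Pi.single n (g n)) := by
  ext1 i
  rw [WithLp.ofLp_sum, Finset.sum_apply]
  rcases i with n | v <;> simp [Finset.sum_pi_single]

variable [Fintype κ]

theorem norm_embed_sq (g : ι → E) : ‖embed κ g‖ ^ 2 = ∑ n, ‖g n‖ ^ 2 := by
  simp [PiLp.norm_sq_eq_of_L2, Fintype.sum_sum_type]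

theorem memLp_embed {Ω : Type*} [MeasurableSpace Ω] {μ : Measure Ω} {g : Ω → ι → E}
    (hg : ∀ n, MemLp (fun ω => g ω n) 2 μ) : MemLp (fun ω => embed κ (g ω)) 2 μ :=
  memLp_piLp_iff.2 fun i => i.casesOn hg fun _ => MemLp.zero

end Embed

section Correction

variable {ι κ : Type*} [Fintype ι] [Fintype κ] {d : ℕ} {π : ι ⊕ κ → ℝ}

theorem act_limitMatrix_apply (π : ι ⊕ κ → ℝ) (Z : Stack (ι ⊕ κ) (EuclideanSpace ℝ (Fin d)))
    (i : ι ⊕ κ) : act (limitMatrix π) Z i = weightedAverage π Z := rfl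

theorem weightedAverage_const (hπ : ∑ i, π i = 1) (x : EuclideanSpace ℝ (Fin d)) :
    weightedAverage π (fun _ => x) = x := by
  rw [weightedAverage, ← Finset.sum_smul, hπ, one_smul]

theorem act_averageMatrix_embed (g : ι → EuclideanSpace ℝ (Fin d)) (i : ι ⊕ κ) :
    act (averageMatrix ι κ) (embed κ g) i = (1 / (Fintype.card ι : ℝ)) • ∑ n, g n := by
  simp [averageMatrix, Finset.smul_sum]

variable [DecidableEq ι] [DecidableEq κ]

theorem act_diagonal_apply {V E : Type*} [Fintype V] [DecidableEq V] [NormedAddCommGroup E]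
    [InnerProductSpace ℝ E] (c : V → ℝ) (Z : Stack V E) (i : V) :
    act (Matrix.diagonal c) Z i = c i • Z i := by
  simp [Matrix.diagonal_apply]

theorem weightedAverage_correction (hπ : ∀ n : ι, 0 < π (.inl n))
    (g : ι → EuclideanSpace ℝ (Fin d)) :
    weightedAverage π (act (Matrix.diagonal (correction π)) (embed κ g))
      = (1 / (Fintype.card ι : ℝ)) • ∑ n, g n := by
  simp only [weightedAverage, act_diagonal_apply, Fintype.sum_sum_type, embed_inl, embed_inr,
    smul_zero, Finset.sum_const_zero, add_zero, correction, Finset.smul_sum, smul_smul]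
  refine Finset.sum_congr rfl fun n _ => ?_
  have hcancel : π (.inl n) * (1 / ((Fintype.card ι : ℝ) * π (.inl n)))
      = 1 / (Fintype.card ι : ℝ) := by
    rw [mul_one_div, mul_comm, div_mul_cancel_left₀ (hπ n).ne', one_div]
  rw [hcancel]

theorem act_limitMatrix_correction (hπ : ∀ n : ι, 0 < π (.inl n))
    (g : ι → EuclideanSpace ℝ (Fin d)) :
    act (limitMatrix π) (act (Matrix.diagonal (correction π)) (embed κ g))
      = act (averageMatrix ι κ) (embed κ g) := by
  ext1 i
  rw [act_limitMatrix_apply, weightedAverage_correction hπ, act_averageMatrix_embed]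

end Correction

section Products

variable {ι κ Ω : Type*} [Fintype ι] [Fintype κ] {W : ℕ → Ω → Matrix (ι ⊕ κ) (ι ⊕ κ) ℝ}
  {π : ι ⊕ κ → ℝ}

/-- The pathwise content of the assumptions on the weights, valid almost surely. -/
structure FixesLimit (W : ℕ → Ω → Matrix (ι ⊕ κ) (ι ⊕ κ) ℝ) (π : ι ⊕ κ → ℝ) (ω : Ω) :
    Prop where
  mul_limit : ∀ k, W k ω * limitMatrix π = limitMatrix π
  limit_mul : ∀ k, limitMatrix π * W k ω = limitMatrix π
  sum_eq_one : ∑ i, π i = 1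
  pos_real : ∀ n : ι, 0 < π (.inl n)

namespace FixesLimit

variable {ω : Ω}

theorem row_sum (h : FixesLimit W π ω) (k : ℕ) (i : ι ⊕ κ) : ∑ j, W k ω i j = 1 := by
  have hentry : ∀ l, (∑ j, W k ω i j) * π l = π l := fun l => by
    simpa only [Matrix.mul_apply, limitMatrix, Matrix.of_apply, ← Finset.sum_mul]
      using congrFun (congrFun (h.mul_limit k) i) l
  calc ∑ j, W k ω i j = (∑ j, W k ω i j) * ∑ l, π l := by rw [h.sum_eq_one, mul_one]
    _ = 1 := by rw [Finset.mul_sum, Finset.sum_congr rfl fun l _ => hentry l, h.sum_eq_one]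

theorem mul_averageMatrix (h : FixesLimit W π ω) (k : ℕ) :
    W k ω * averageMatrix ι κ = averageMatrix ι κ := by
  ext i j
  simp only [Matrix.mul_apply, averageMatrix, Matrix.of_apply, ← Finset.sum_mul, h.row_sum,
    one_mul]

theorem limitMatrix_mul_self (h : FixesLimit W π ω) :
    limitMatrix π * limitMatrix π = limitMatrix π := by
  ext i j
  simp only [Matrix.mul_apply, limitMatrix, Matrix.of_apply, ← Finset.sum_mul, h.sum_eq_one,
    one_mul]

theorem weightedAverage_act {d : ℕ} (h : FixesLimit W π ω) (k : ℕ)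
    (Z : Stack (ι ⊕ κ) (EuclideanSpace ℝ (Fin d))) :
    weightedAverage π (act (W k ω) Z) = weightedAverage π Z := by
  obtain ⟨i, -⟩ : ∃ i, i ∈ Finset.univ ∧ π i ≠ 0 :=
    Finset.exists_ne_zero_of_sum_ne_zero (h.sum_eq_one ▸ one_ne_zero)
  rw [← act_limitMatrix_apply π _ i, ← act_mul, h.limit_mul, act_limitMatrix_apply]

end FixesLimit

variable [DecidableEq ι] [DecidableEq κ]

theorem GossipAssumption.ae_fixesLimit [MeasurableSpace Ω] {μ : Measure Ω} {p β : ℝ} {τ : ℕ}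
    (h : GossipAssumption μ W π p τ β) : ∀ᵐ ω ∂μ, FixesLimit W π ω := by
  filter_upwards [ae_all_iff.2 h.mul_limit, ae_all_iff.2 h.limit_mul] with ω hmul hlim
  exact ⟨hmul, hlim, h.sum_eq_one, h.pos_real⟩

/-- The corrected and centred products `W^[s+r-1] ⋯ W^[s] D - J`, through which the gradients of
round `s` enter the deviations of round `s + r`. -/
def centredProd (W : ℕ → Ω → Matrix (ι ⊕ κ) (ι ⊕ κ) ℝ) (π : ι ⊕ κ → ℝ) (s r : ℕ) (ω : Ω) :
    Matrix (ι ⊕ κ) (ι ⊕ κ) ℝ :=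
  gossipProd W s r ω * Matrix.diagonal (correction π) - averageMatrix ι κ

theorem FixesLimit.mul_centredProd {ω : Ω} (h : FixesLimit W π ω) (s r : ℕ) :
    W (s + r) ω * centredProd W π s r ω = centredProd W π s (r + 1) ω := by
  simp only [centredProd, Matrix.mul_sub, h.mul_averageMatrix, ← Matrix.mul_assoc, gossipProd]

end Products

/-- The data of a run of DT-GO. -/
structure Run (ι κ Ω Ξ : Type*) [MeasurableSpace Ξ] (d : ℕ) where
  /-- The laws of the samples. -/
  𝒟 : ι → Measure Ξ
  /-- The stochastic costs. -/
  F : ι → EuclideanSpace ℝ (Fin d) → Ξ → ℝ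
  /-- The weight matrices. -/
  W : ℕ → Ω → Matrix (ι ⊕ κ) (ι ⊕ κ) ℝ
  /-- The rows of the limit matrix. -/
  π : ι ⊕ κ → ℝ
  /-- The samples. -/
  ξ : ℕ → ι → Ω → Ξ
  /-- The step size. -/
  η : ℝ
  /-- The common initial state. -/
  x₀ : EuclideanSpace ℝ (Fin d)

namespace Run

variable {ι κ Ω Ξ : Type*} [Fintype ι] [Fintype κ] [MeasurableSpace Ξ] {d : ℕ}
  (R : Run ι κ Ω Ξ d)

/-- The stacked iterates `x_n^[k]`. -/
def state (k : ℕ) (ω : Ω) : Stack (ι ⊕ κ) (EuclideanSpace ℝ (Fin d)) :=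
  WithLp.toLp 2 (iterate R.W R.F R.π R.ξ R.η R.x₀ k ω)

/-- The average `x̃^[k]`. -/
def avg (k : ℕ) (ω : Ω) : EuclideanSpace ℝ (Fin d) :=
  weightedAverage R.π (R.state k ω)

/-- The deviations of the states from their average, including those of the virtual nodes. -/
def dev (k : ℕ) (ω : Ω) : Stack (ι ⊕ κ) (EuclideanSpace ℝ (Fin d)) :=
  R.state k ω - act (limitMatrix R.π) (R.state k ω)

/-- The stochastic gradients of round `k`. -/
def grad (k : ℕ) (ω : Ω) (n : ι) : EuclideanSpace ℝ (Fin d) :=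
  stochGrad R.F n (R.state k ω (.inl n)) (R.ξ k n ω)

/-- The gradients of the local objectives at the states of round `k`. -/
def meanGrad (k : ℕ) (ω : Ω) (n : ι) : EuclideanSpace ℝ (Fin d) :=
  gradient (localCost R.𝒟 R.F n) (R.state k ω (.inl n))

/-- The gradient noise of round `k`. -/
def noise (k : ℕ) (ω : Ω) (n : ι) : EuclideanSpace ℝ (Fin d) :=
  gradNoise R.𝒟 R.F n (R.state k ω (.inl n)) (R.ξ k n ω)

variable {R}

theorem grad_eq_meanGrad_add_noise (k : ℕ) (ω : Ω) :
    R.grad k ω = R.meanGrad k ω + R.noise k ω :=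
  funext fun _ => (add_sub_cancel _ _).symm

theorem state_zero (ω : Ω) : R.state 0 ω = WithLp.toLp 2 fun _ => R.x₀ := rfl

theorem dev_apply (k : ℕ) (ω : Ω) (i : ι ⊕ κ) : R.dev k ω i = R.state k ω i - R.avg k ω := rfl

theorem avg_zero (hπ : ∑ i, R.π i = 1) (ω : Ω) : R.avg 0 ω = R.x₀ :=
  weightedAverage_const hπ R.x₀

theorem dev_zero (hπ : ∑ i, R.π i = 1) (ω : Ω) : R.dev 0 ω = 0 := by
  ext1 i
  rw [dev_apply, avg_zero hπ]
  exact sub_self R.x₀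

theorem act_limitMatrix_dev {ω : Ω} (h : FixesLimit R.W R.π ω) (k : ℕ) :
    act (limitMatrix R.π) (R.dev k ω) = 0 := by
  rw [dev, map_sub, ← act_mul, h.limitMatrix_mul_self, sub_self]

theorem state_succ [DecidableEq ι] [DecidableEq κ] (k : ℕ) (ω : Ω) :
    R.state (k + 1) ω = act (R.W k ω) (R.state k ω
      - R.η • act (Matrix.diagonal (correction R.π)) (embed κ (R.grad k ω))) := by
  ext1 i
  refine Finset.sum_congr rfl fun j _ => congrArg (R.W k ω i j • ·) ?_
  rw [PiLp.sub_apply, PiLp.smul_apply, act_diagonal_apply]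
  rcases j with n | v
  · simp only [localStep, embed_inl, correction, grad]
    rw [sub_sub_cancel_left, smul_neg, ← sub_eq_add_neg, smul_comm]
    rfl
  · simp only [localStep, embed_inr, smul_zero, sub_zero]
    rfl

variable {ω : Ω}

theorem avg_succ (h : FixesLimit R.W R.π ω) (k : ℕ) :
    R.avg (k + 1) ω
      = R.avg k ω - R.η • ((1 / (Fintype.card ι : ℝ)) • ∑ n, R.grad k ω n) := by
  classical
  rw [avg, state_succ, h.weightedAverage_act, ← weightedAverage_correction h.pos_real, avg]
  simp only [weightedAverage, PiLp.sub_apply, PiLp.smul_apply, smul_sub, Finset.sum_sub_distrib,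
    Finset.smul_sum, smul_comm R.η]

variable [DecidableEq ι] [DecidableEq κ]

theorem dev_succ (h : FixesLimit R.W R.π ω) (k : ℕ) :
    R.dev (k + 1) ω = act (R.W k ω) (R.dev k ω)
      - R.η • act (centredProd R.W R.π k 1 ω) (embed κ (R.grad k ω)) := by
  have hprod : gossipProd R.W k 1 ω = R.W k ω := mul_one _
  rw [centredProd, hprod, dev, state_succ, ← act_mul, h.limit_mul, map_sub, map_sub, map_smul,
    map_smul, act_limitMatrix_correction h.pos_real, act_sub_matrix, act_mul, dev, map_sub,
    ← act_mul (R.W k ω) (limitMatrix R.π), h.mul_limit]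
  module

/-- What the vectors `g`, injected at the real nodes in the rounds `s, …, s + r - 1`, have become
in the deviations of round `s + r`. -/
def propagated (R : Run ι κ Ω Ξ d) (g : ℕ → Ω → ι → EuclideanSpace ℝ (Fin d)) (s r : ℕ)
    (ω : Ω) : Stack (ι ⊕ κ) (EuclideanSpace ℝ (Fin d)) :=
  ∑ l ∈ Finset.range r, act (centredProd R.W R.π (s + l) (r - l) ω) (embed κ (g (s + l) ω))

theorem propagated_add (g h : ℕ → Ω → ι → EuclideanSpace ℝ (Fin d)) (s r : ℕ) :
    R.propagated (fun k ω => g k ω + h k ω) s r ω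
      = R.propagated g s r ω + R.propagated h s r ω := by
  simp only [propagated, embed_add, map_add, Finset.sum_add_distrib]

theorem propagated_succ (h : FixesLimit R.W R.π ω)
    (g : ℕ → Ω → ι → EuclideanSpace ℝ (Fin d)) (s r : ℕ) :
    R.propagated g s (r + 1) ω = act (R.W (s + r) ω) (R.propagated g s r ω)
      + act (centredProd R.W R.π (s + r) 1 ω) (embed κ (g (s + r) ω)) := by
  simp only [propagated, Finset.sum_range_succ, map_sum, add_tsub_cancel_left]
  refine congrArg (· + _) (Finset.sum_congr rfl fun l hl => ?_)
  have hl' : l ≤ r := (Finset.mem_range.1 hl).le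
  have hround : s + r = s + l + (r - l) := by omega
  rw [← act_mul, hround, h.mul_centredProd, Nat.sub_add_comm hl']

theorem dev_add (h : FixesLimit R.W R.π ω) (s r : ℕ) :
    R.dev (s + r) ω = act (gossipProd R.W s r ω - limitMatrix R.π) (R.dev s ω)
      - R.η • R.propagated R.grad s r ω := by
  rw [act_sub_matrix, act_limitMatrix_dev h, sub_zero]
  induction r with
  | zero => simp only [gossipProd, act_one, propagated, Finset.range_zero, Finset.sum_empty,
      smul_zero, sub_zero, add_zero]
  | succ r ih =>
    rw [← add_assoc, dev_succ h, ih, propagated_succ h, map_sub, map_smul, gossipProd, act_mul,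
      smul_add, sub_sub]

end Run

/-! ### Measurability and integrability along a run -/

section Products

variable {Ω : Type*} {m : MeasurableSpace Ω}

theorem measurable_gossipProd {V : Type*} [Fintype V] [DecidableEq V]
    {W : ℕ → Ω → Matrix V V ℝ} {s r : ℕ}
    (hW : ∀ k, s ≤ k → k < s + r → ∀ i j, Measurable fun ω => W k ω i j) (i j : V) :
    Measurable fun ω => gossipProd W s r ω i j := by
  induction r generalizing i j with
  | zero =>
    simp only [gossipProd]
    exact measurable_const
  | succ r ih =>
    simp only [gossipProd, Matrix.mul_apply]
    exact Finset.measurable_sum _ fun l _ => (hW _ (by omega) (by omega) i l).mul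
      (ih (fun k hs hr => hW k hs (by omega)) l j)

theorem measurable_centredProd {ι κ : Type*} [Fintype ι] [DecidableEq ι] [Fintype κ]
    [DecidableEq κ] {W : ℕ → Ω → Matrix (ι ⊕ κ) (ι ⊕ κ) ℝ} {π : ι ⊕ κ → ℝ} {s r : ℕ}
    (hW : ∀ k, s ≤ k → k < s + r → ∀ i j, Measurable fun ω => W k ω i j) (i j : ι ⊕ κ) :
    Measurable fun ω => centredProd W π s r ω i j := by
  simp only [centredProd, Matrix.sub_apply, Matrix.mul_diagonal]
  exact ((measurable_gossipProd hW i j).mul_const _).sub_const _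

end Products

theorem memLp_act {V E Ω : Type*} [Fintype V] [NormedAddCommGroup E] [InnerProductSpace ℝ E]
    [FiniteDimensional ℝ E] [MeasurableSpace Ω] {μ : Measure Ω} (A : Matrix V V ℝ)
    {Z : Ω → Stack V E} (hZ : MemLp Z 2 μ) :
    MemLp (fun ω => act A (Z ω)) 2 μ := by
  classical
  exact hZ.of_le_mul ((act A).continuous_of_finiteDimensional.comp_aestronglyMeasurable hZ.1)
    (.of_forall fun ω => norm_act_le A (Z ω))

theorem GossipAssumption.integrable_specNorm_sq {ι κ Ω : Type*} [Fintype ι] [DecidableEq ι]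
    [Fintype κ] [DecidableEq κ] [MeasurableSpace Ω] {μ : Measure Ω} [IsFiniteMeasure μ]
    {W : ℕ → Ω → Matrix (ι ⊕ κ) (ι ⊕ κ) ℝ} {π : ι ⊕ κ → ℝ} {p β : ℝ} {τ : ℕ}
    (h : GossipAssumption μ W π p τ β) (hW : ∀ k i j, Measurable fun ω => W k ω i j) (k : ℕ) :
    Integrable (fun ω => specNorm (W k ω) ^ 2) μ := by
  set D' : Matrix (ι ⊕ κ) (ι ⊕ κ) ℝ := Matrix.diagonal fun i => (correction π i)⁻¹
  have hcorr : ∀ i, correction π i * (correction π i)⁻¹ = 1 := fun i => by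
    refine mul_inv_cancel₀ ?_
    rcases i with n | _
    · have : Nonempty ι := ⟨n⟩
      exact one_div_ne_zero (mul_ne_zero (Nat.cast_ne_zero.2 Fintype.card_ne_zero)
        (h.pos_real n).ne')
    · exact one_ne_zero
  have hfactor : ∀ ω, W k ω = (centredProd W π k 1 ω + averageMatrix ι κ) * D' := fun ω => by
    rw [centredProd, sub_add_cancel, Matrix.mul_assoc, Matrix.diagonal_mul_diagonal]
    simp only [hcorr, Matrix.diagonal_one, mul_one, gossipProd, add_zero]
  have hbound : ∀ ω, specNorm (W k ω) ^ 2 ≤ 2 * (specNorm (centredProd W π k 1 ω) ^ 2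
      + specNorm (averageMatrix ι κ) ^ 2) * specNorm D' ^ 2 := fun ω => by
    have hC : 0 ≤ specNorm (centredProd W π k 1 ω + averageMatrix ι κ) := norm_nonneg _
    calc specNorm (W k ω) ^ 2
        ≤ (specNorm (centredProd W π k 1 ω + averageMatrix ι κ) * specNorm D') ^ 2 := by
          rw [hfactor ω]
          exact pow_le_pow_left₀ (norm_nonneg _) (specNorm_mul_le _ _) 2
      _ ≤ _ := by
          rw [mul_pow]
          gcongr
          exact (pow_le_pow_left₀ hC (specNorm_add_le _ _) 2).trans add_sq_le
  have hdom := (((h.bounded k 1 le_rfl h.one_le_tau).1.add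
    (integrable_const (specNorm (averageMatrix ι κ) ^ 2))).const_mul 2).mul_const (specNorm D' ^ 2)
  refine hdom.mono' ((measurable_specNorm (hW k)).pow_const 2).aestronglyMeasurable
    (.of_forall fun ω => ?_)
  rw [Real.norm_of_nonneg (sq_nonneg _)]
  exact hbound ω

section Costs

variable {Ω ι Ξ : Type*} [MeasurableSpace Ω] {μ : Measure Ω} [IsFiniteMeasure μ]
  [MeasurableSpace Ξ] [Fintype ι] {d : ℕ} {𝒟 : ι → Measure Ξ} [∀ n, IsProbabilityMeasure (𝒟 n)]
  {F : ι → EuclideanSpace ℝ (Fin d) → Ξ → ℝ} {L : ℝ} {xs : EuclideanSpace ℝ (Fin d)}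
  {x : Ω → EuclideanSpace ℝ (Fin d)}

namespace ConvexCosts

theorem memLp_gradient (h : ConvexCosts 𝒟 F L xs) (hL : 0 ≤ L) (n : ι) (hx : MemLp x 2 μ) :
    MemLp (fun ω => gradient (localCost 𝒟 F n) (x ω)) 2 μ := by
  have hs := h.smoothConvex_localCost hL n
  have hdiff : MemLp (fun ω => gradient (localCost 𝒟 F n) (x ω) - gradient (localCost 𝒟 F n) xs)
      2 μ :=
    (hx.sub (memLp_const xs)).of_le_mul
      ((hs.continuous_grad.comp_aestronglyMeasurable hx.1).sub aestronglyMeasurable_const)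
      (.of_forall fun ω => hs.norm_grad_sub_le (x ω) xs)
  refine (hdiff.add (memLp_const (gradient (localCost 𝒟 F n) xs))).ae_eq (.of_forall fun ω => ?_)
  exact sub_add_cancel _ _

theorem integrable_localGap (h : ConvexCosts 𝒟 F L xs) (hL : 0 ≤ L) (n : ι)
    (hx : MemLp x 2 μ) : Integrable (fun ω => localGap 𝒟 F xs n (x ω)) μ := by
  have hs := h.smoothConvex_localCost hL n
  have hcont := hs.continuous
  have hgap : Continuous (localGap 𝒟 F xs n) := by
    unfold localGap bregman
    fun_prop
  refine ((integrable_norm_sq (hx.sub (memLp_const xs))).const_mul (L / 2)).mono'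
    (hgap.comp_aestronglyMeasurable hx.1) (.of_forall fun ω => ?_)
  rw [Real.norm_of_nonneg (h.localGap_nonneg hL n (x ω))]
  exact hs.bregman_le (x ω) xs

theorem integrable_globalCost [Nonempty ι] (h : ConvexCosts 𝒟 F L xs) (hL : 0 ≤ L)
    (hx : MemLp x 2 μ) : Integrable (fun ω => globalCost 𝒟 F (x ω)) μ := by
  have hN : (Fintype.card ι : ℝ) ≠ 0 := Nat.cast_ne_zero.2 Fintype.card_ne_zero
  have hgap := (integrable_finsetSum Finset.univ fun n _ => h.integrable_localGap hL n hx).const_mul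
    (1 / (Fintype.card ι : ℝ))
  refine (hgap.add (integrable_const (globalCost 𝒟 F xs))).congr (.of_forall fun ω => ?_)
  simp only [Pi.add_apply, h.sum_localGap hL, one_div, inv_mul_cancel_left₀ hN, sub_add_cancel]

end ConvexCosts

end Costs

section Past

variable {ι : Type*}

/-- The weight matrices from round `s` on. -/
def weightsFrom (ι : Type*) (s : ℕ) : Set (ℕ ⊕ ℕ × ι) := Sum.inl '' Set.Ici s

/-- The information in `S` determines what happens before round `k`. -/
structure Past (S : Set (ℕ ⊕ ℕ × ι)) (k : ℕ) : Prop where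
  weight : ∀ l < k, .inl l ∈ S
  sample : ∀ l < k, ∀ n, .inr (l, n) ∈ S

theorem inr_mem_weightsFrom_compl (s : ℕ) (q : ℕ × ι) :
    (.inr q : ℕ ⊕ ℕ × ι) ∈ (weightsFrom ι s)ᶜ := by
  simp [weightsFrom]

theorem past_weightsFrom_compl {k s : ℕ} (h : k ≤ s) : Past (weightsFrom ι s)ᶜ k where
  weight l hl := by simp [weightsFrom, hl.trans_le h]
  sample l _ n := inr_mem_weightsFrom_compl s (l, n)

theorem past_sample_compl {k l : ℕ} (h : k ≤ l) (n : ι) :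
    Past ({.inr (l, n)}ᶜ : Set (ℕ ⊕ ℕ × ι)) k where
  weight j _ := by simp
  sample j hj m := by simp [(hj.trans_le h).ne]

end Past

section Run

variable {ι κ Ω Ξ : Type*} [Fintype ι] [DecidableEq ι] [Fintype κ] [DecidableEq κ]
  [MeasurableSpace Ω] [MeasurableSpace Ξ] {d : ℕ}

/-- The assumptions of the theorem on a run of DT-GO. -/
structure Setting (R : Run ι κ Ω Ξ d) (μ : Measure Ω) (p : ℝ) (τ : ℕ) (β L : ℝ)
    (xs : EuclideanSpace ℝ (Fin d)) : Prop where
  random : RandomModel μ R.W R.𝒟 R.ξ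
  gossip : GossipAssumption μ R.W R.π p τ β
  costs : ConvexCosts R.𝒟 R.F L xs
  L_nonneg : 0 ≤ L

namespace Setting

variable {R : Run ι κ Ω Ξ d} {μ : Measure Ω} {p : ℝ} {τ : ℕ} {β L : ℝ}
  {xs : EuclideanSpace ℝ (Fin d)} {S : Set (ℕ ⊕ ℕ × ι)} {k : ℕ}

theorem indep_weightsFrom (h : Setting R μ p τ β L xs) (s : ℕ) :
    Indep (infoOn R.W R.ξ (weightsFrom ι s)) (infoOn R.W R.ξ (weightsFrom ι s)ᶜ) μ :=
  h.random.indep_infoOn disjoint_compl_right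

theorem measurable_state (h : Setting R μ p τ β L xs) (hS : Past S k) :
    Measurable[infoOn R.W R.ξ S] (R.state k) := by
  induction k with
  | zero =>
    simp_rw [funext R.state_zero]
    exact measurable_const
  | succ k ih =>
    have hstate := ih ⟨fun l hl => hS.weight l (by omega), fun l hl => hS.sample l (by omega)⟩
    have hgrad : Measurable[infoOn R.W R.ξ S] fun ω => embed κ (R.grad k ω) :=
      measurable_embed fun n => (h.costs.measurable_uncurry_stochGrad h.L_nonneg n).comp
        ((measurable_stack_apply hstate _).prodMk
          (measurable_sample_infoOn (hS.sample k (by omega) n)))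
    have hcorr := measurable_act (A := fun _ => Matrix.diagonal (correction R.π))
      (fun _ _ => measurable_const) hgrad
    simp_rw [funext (R.state_succ k)]
    exact measurable_act (measurable_weight_infoOn (hS.weight k (by omega)))
      (hstate.sub (hcorr.const_smul R.η))

theorem measurable_avg (h : Setting R μ p τ β L xs) (hS : Past S k) :
    Measurable[infoOn R.W R.ξ S] (R.avg k) :=
  Finset.measurable_sum _ fun i _ =>
    (measurable_stack_apply (h.measurable_state hS) i).const_smul (R.π i)

theorem measurable_dev (h : Setting R μ p τ β L xs) (hS : Past S k) :
    Measurable[infoOn R.W R.ξ S] (R.dev k) :=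
  (h.measurable_state hS).sub
    (measurable_act (fun _ _ => measurable_const) (h.measurable_state hS))

theorem memLp_centredProd_act (h : Setting R μ p τ β L xs) {s r : ℕ} (hr : 1 ≤ r) (hrτ : r ≤ τ)
    {Z : Ω → Stack (ι ⊕ κ) (EuclideanSpace ℝ (Fin d))}
    (hZ : Measurable[infoOn R.W R.ξ (weightsFrom ι s)ᶜ] Z) (hZ2 : MemLp Z 2 μ) :
    MemLp (fun ω => act (centredProd R.W R.π s r ω) (Z ω)) 2 μ ∧
      ∫ ω, ‖act (centredProd R.W R.π s r ω) (Z ω)‖ ^ 2 ∂μ ≤ β ^ 2 * ∫ ω, ‖Z ω‖ ^ 2 ∂μ := by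
  obtain ⟨hint, hle⟩ := h.gossip.bounded s r hr hrτ
  have hmeas := measurable_centredProd (m := infoOn R.W R.ξ (weightsFrom ι s)) (W := R.W)
    (π := R.π) (s := s) (r := r) fun k hk _ =>
      measurable_weight_infoOn (Set.mem_image_of_mem Sum.inl hk)
  obtain ⟨hmem, hact⟩ := memLp_act_of_indep (h.random.infoOn_le _) (h.random.infoOn_le _)
    (h.indep_weightsFrom s) hmeas hZ hint hZ2
  exact ⟨hmem, hact.trans (mul_le_mul_of_nonneg_right hle (integral_nonneg fun ω => sq_nonneg _))⟩

variable [∀ n, IsProbabilityMeasure (R.𝒟 n)]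

theorem measurable_meanGrad (h : Setting R μ p τ β L xs) (hS : Past S k) (n : ι) :
    Measurable[infoOn R.W R.ξ S] fun ω => R.meanGrad k ω n :=
  (h.costs.smoothConvex_localCost h.L_nonneg n).continuous_grad.measurable.comp
    (measurable_stack_apply (h.measurable_state hS) _)

theorem measurable_noise (h : Setting R μ p τ β L xs) (hS : Past S k) {n : ι}
    (hn : .inr (k, n) ∈ S) : Measurable[infoOn R.W R.ξ S] fun ω => R.noise k ω n := by
  have hx := measurable_stack_apply (h.measurable_state hS) (.inl n)
  have hξ := measurable_sample_infoOn (W := R.W) (ξ := R.ξ) hn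
  exact (h.costs.measurable_gradNoise h.L_nonneg n).comp
    (f := fun ω => (R.state k ω (.inl n), R.ξ k n ω)) (hx.prodMk hξ)

variable [IsProbabilityMeasure μ]

theorem memLp_meanGrad_of_state (h : Setting R μ p τ β L xs) (hx : MemLp (R.state k) 2 μ) (n : ι) :
    MemLp (fun ω => R.meanGrad k ω n) 2 μ :=
  h.costs.memLp_gradient h.L_nonneg n (memLp_piLp_iff.1 hx (.inl n))

theorem memLp_noise_of_state (h : Setting R μ p τ β L xs) (hx : MemLp (R.state k) 2 μ) (n : ι) :
    MemLp (fun ω => R.noise k ω n) 2 μ :=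
  (h.costs.integral_gradNoise_comp_sq_le h.L_nonneg (h.random.infoOn_le _)
    (h.random.measurable_sample k n) (h.random.law k n) (h.random.indep_infoOn_compl_sample k n)
    (measurable_stack_apply (h.measurable_state (past_sample_compl le_rfl n)) _)
    (y := fun _ => xs) measurable_const
    (integrable_norm_sq ((memLp_piLp_iff.1 hx (.inl n)).sub (memLp_const xs)))
    (integrable_const _)).1

theorem memLp_state (h : Setting R μ p τ β L xs) (k : ℕ) : MemLp (R.state k) 2 μ := by
  induction k with
  | zero =>
    simp_rw [funext R.state_zero]
    exact memLp_const _
  | succ k ih =>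
    have hpast : Past (weightsFrom ι k)ᶜ k := past_weightsFrom_compl le_rfl
    have hgrad : MemLp (fun ω => embed κ (R.grad k ω)) 2 μ := memLp_embed fun n => by
      simp_rw [Run.grad_eq_meanGrad_add_noise]
      exact (h.memLp_meanGrad_of_state ih n).add (h.memLp_noise_of_state ih n)
    have hgradm : Measurable[infoOn R.W R.ξ (weightsFrom ι k)ᶜ] fun ω => embed κ (R.grad k ω) :=
      measurable_embed fun n => by
        simp_rw [Run.grad_eq_meanGrad_add_noise]
        exact (h.measurable_meanGrad hpast n).add
          (h.measurable_noise hpast (inr_mem_weightsFrom_compl k (k, n)))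
    have hcorrm := measurable_act (A := fun _ => Matrix.diagonal (correction R.π))
      (fun _ _ => measurable_const) hgradm
    simp_rw [funext (R.state_succ k)]
    exact (memLp_act_of_indep (h.random.infoOn_le _) (h.random.infoOn_le _) (h.indep_weightsFrom k)
      (measurable_weight_infoOn (Set.mem_image_of_mem Sum.inl Set.self_mem_Ici))
      ((h.measurable_state hpast).sub (hcorrm.const_smul R.η))
      (h.gossip.integrable_specNorm_sq h.random.measurable_weight k)
      (ih.sub ((memLp_act _ hgrad).const_smul R.η))).1

theorem memLp_meanGrad (h : Setting R μ p τ β L xs) (k : ℕ) (n : ι) :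
    MemLp (fun ω => R.meanGrad k ω n) 2 μ :=
  h.memLp_meanGrad_of_state (h.memLp_state k) n

theorem memLp_noise (h : Setting R μ p τ β L xs) (k : ℕ) (n : ι) :
    MemLp (fun ω => R.noise k ω n) 2 μ :=
  h.memLp_noise_of_state (h.memLp_state k) n

theorem memLp_avg (h : Setting R μ p τ β L xs) (k : ℕ) : MemLp (R.avg k) 2 μ :=
  memLp_finsetSum _ fun i _ => (memLp_piLp_iff.1 (h.memLp_state k) i).const_smul (R.π i)

theorem memLp_dev (h : Setting R μ p τ β L xs) (k : ℕ) : MemLp (R.dev k) 2 μ :=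
  (h.memLp_state k).sub (memLp_act _ (h.memLp_state k))

end Setting

end Run

/-! ### Second moments of gradients and noise -/

section Levels

variable {ι Ξ : Type*} [Fintype ι] [Nonempty ι] [MeasurableSpace Ξ] {d : ℕ}
  (𝒟 : ι → Measure Ξ) (F : ι → EuclideanSpace ℝ (Fin d) → Ξ → ℝ) (xs : EuclideanSpace ℝ (Fin d))

theorem card_mul_heterogeneity_sq :
    Fintype.card ι * heterogeneity 𝒟 F xs ^ 2 = ∑ n, ‖gradient (localCost 𝒟 F n) xs‖ ^ 2 := by
  have hN : (Fintype.card ι : ℝ) ≠ 0 := Nat.cast_ne_zero.2 Fintype.card_ne_zero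
  rw [heterogeneity, Real.sq_sqrt (by positivity), one_div, mul_inv_cancel_left₀ hN]

theorem card_mul_noiseLevel_sq :
    Fintype.card ι * noiseLevel 𝒟 F xs ^ 2 = ∑ n, noiseSq 𝒟 F xs n := by
  have hN : (Fintype.card ι : ℝ) ≠ 0 := Nat.cast_ne_zero.2 Fintype.card_ne_zero
  have hsum : 0 ≤ ∑ n, noiseSq 𝒟 F xs n :=
    Finset.sum_nonneg fun n _ => integral_nonneg fun z => sq_nonneg _
  rw [noiseLevel, Real.sq_sqrt (by positivity), one_div, mul_inv_cancel_left₀ hN]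

end Levels

theorem integral_norm_embed_sq {ι κ E Ω : Type*} [Fintype ι] [Fintype κ] [NormedAddCommGroup E]
    [MeasurableSpace Ω] {μ : Measure Ω} {g : Ω → ι → E} (hg : ∀ n, MemLp (fun ω => g ω n) 2 μ) :
    ∫ ω, ‖embed κ (g ω)‖ ^ 2 ∂μ = ∑ n, ∫ ω, ‖g ω n‖ ^ 2 ∂μ := by
  simp_rw [norm_embed_sq]
  exact integral_finsetSum _ fun n _ => integrable_norm_sq (hg n)

theorem inner_act_embed_single {ι κ E : Type*} [Fintype ι] [DecidableEq ι] [Fintype κ]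
    [NormedAddCommGroup E] [InnerProductSpace ℝ E] (A : Matrix (ι ⊕ κ) (ι ⊕ κ) ℝ)
    (Z : Stack (ι ⊕ κ) E) (n : ι) (v : E) :
    inner ℝ Z (act A (embed κ (Pi.single n v))) = inner ℝ (act A.transpose Z (.inl n)) v := by
  have hcolumn : ∀ i, act A (embed κ (Pi.single n v)) i = A i (.inl n) • v := fun i => by
    simp [Pi.single_apply]
  simp only [PiLp.inner_apply, hcolumn, act_apply, sum_inner, Matrix.transpose_apply,
    real_inner_smul_left, real_inner_smul_right]

section Run

variable {ι κ Ω Ξ : Type*} [Fintype ι] [Fintype κ] [MeasurableSpace Ξ] {d : ℕ}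

theorem Run.sum_norm_state_sub_avg_sq_le (R : Run ι κ Ω Ξ d) (k : ℕ) (ω : Ω) :
    ∑ n, ‖R.state k ω (.inl n) - R.avg k ω‖ ^ 2 ≤ ‖R.dev k ω‖ ^ 2 := by
  rw [PiLp.norm_sq_eq_of_L2, Fintype.sum_sum_type]
  exact le_add_of_nonneg_right (Finset.sum_nonneg fun _ _ => sq_nonneg _)

variable [MeasurableSpace Ω]

/-- The mean square deviation of the states of round `k` from their average. -/
def Run.devSq (R : Run ι κ Ω Ξ d) (μ : Measure Ω) (k : ℕ) : ℝ :=
  ∫ ω, ‖R.dev k ω‖ ^ 2 ∂μ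

/-- The expected suboptimality of the average of round `k`, compared with the point `xs`. -/
def Run.meanGap (R : Run ι κ Ω Ξ d) (μ : Measure Ω) (xs : EuclideanSpace ℝ (Fin d)) (k : ℕ) : ℝ :=
  ∫ ω, (globalCost R.𝒟 R.F (R.avg k ω) - globalCost R.𝒟 R.F xs) ∂μ

theorem Run.devSq_nonneg (R : Run ι κ Ω Ξ d) (μ : Measure Ω) (k : ℕ) : 0 ≤ R.devSq μ k :=
  integral_nonneg fun _ => sq_nonneg _

namespace Setting

variable {R : Run ι κ Ω Ξ d} {μ : Measure Ω} {p : ℝ} {τ : ℕ} {β L : ℝ}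
  {xs : EuclideanSpace ℝ (Fin d)} [DecidableEq ι] [DecidableEq κ] [IsProbabilityMeasure μ]
  [∀ n, IsProbabilityMeasure (R.𝒟 n)]

theorem memLp_state_sub_avg (h : Setting R μ p τ β L xs) (k : ℕ) (n : ι) :
    MemLp (fun ω => R.state k ω (.inl n) - R.avg k ω) 2 μ :=
  (memLp_piLp_iff.1 (h.memLp_state k) _).sub (h.memLp_avg k)

theorem sum_integral_norm_state_sub_avg_sq_le (h : Setting R μ p τ β L xs) (k : ℕ) :
    ∑ n, ∫ ω, ‖R.state k ω (.inl n) - R.avg k ω‖ ^ 2 ∂μ ≤ R.devSq μ k := by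
  have hint := fun n => integrable_norm_sq (h.memLp_state_sub_avg k n)
  rw [← integral_finsetSum _ fun n _ => hint n]
  exact integral_mono (integrable_finsetSum _ fun n _ => hint n)
    (integrable_norm_sq (h.memLp_dev k)) (R.sum_norm_state_sub_avg_sq_le k)

variable [Nonempty ι]

theorem integrable_gap (h : Setting R μ p τ β L xs) (k : ℕ) :
    Integrable (fun ω => globalCost R.𝒟 R.F (R.avg k ω) - globalCost R.𝒟 R.F xs) μ :=
  (h.costs.integrable_globalCost h.L_nonneg (h.memLp_avg k)).sub (integrable_const _)

theorem sum_integral_localGap_avg (h : Setting R μ p τ β L xs) (k : ℕ) :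
    ∑ n, ∫ ω, localGap R.𝒟 R.F xs n (R.avg k ω) ∂μ = Fintype.card ι * R.meanGap μ xs k := by
  rw [Run.meanGap, ← integral_const_mul, ← integral_finsetSum _ fun n _ =>
    h.costs.integrable_localGap h.L_nonneg n (h.memLp_avg k)]
  simp_rw [h.costs.sum_localGap h.L_nonneg]

theorem sum_local_bound_le (h : Setting R μ p τ β L xs) (k : ℕ) (c : ι → ℝ) :
    ∑ n, (3 * L ^ 2 * ∫ ω, ‖R.state k ω (.inl n) - R.avg k ω‖ ^ 2 ∂μ
      + 6 * L * ∫ ω, localGap R.𝒟 R.F xs n (R.avg k ω) ∂μ + 3 * c n)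
    ≤ 3 * L ^ 2 * R.devSq μ k + 6 * L * (Fintype.card ι * R.meanGap μ xs k) + 3 * ∑ n, c n := by
  rw [Finset.sum_add_distrib, Finset.sum_add_distrib, ← Finset.mul_sum, ← Finset.mul_sum,
    ← Finset.mul_sum, h.sum_integral_localGap_avg]
  gcongr
  exact h.sum_integral_norm_state_sub_avg_sq_le k

theorem integral_meanGrad_sq_le (h : Setting R μ p τ β L xs) (k : ℕ) :
    ∫ ω, ‖embed κ (R.meanGrad k ω)‖ ^ 2 ∂μ ≤ 3 * L ^ 2 * R.devSq μ k
      + 6 * L * (Fintype.card ι * R.meanGap μ xs k)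
      + 3 * (Fintype.card ι * heterogeneity R.𝒟 R.F xs ^ 2) := by
  rw [card_mul_heterogeneity_sq, integral_norm_embed_sq (h.memLp_meanGrad k)]
  refine le_trans (Finset.sum_le_sum fun n _ => ?_) (h.sum_local_bound_le k _)
  have hdev := (integrable_norm_sq (h.memLp_state_sub_avg k n)).const_mul (3 * L ^ 2)
  have hgap := (h.costs.integrable_localGap h.L_nonneg n (h.memLp_avg k)).const_mul (6 * L)
  have hbound := integral_mono (integrable_norm_sq (h.memLp_meanGrad k n))
    ((hdev.add hgap).add (integrable_const (3 * ‖gradient (localCost R.𝒟 R.F n) xs‖ ^ 2)))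
    fun ω => h.costs.norm_gradient_sq_le h.L_nonneg n (R.state k ω (.inl n)) (R.avg k ω)
  simp only [Pi.add_apply] at hbound
  rwa [integral_add₃ hdev hgap (integrable_const _), integral_const_mul, integral_const_mul,
    integral_const, probReal_univ, one_smul] at hbound

theorem integral_noise_sq_le (h : Setting R μ p τ β L xs) (k : ℕ) :
    ∫ ω, ‖embed κ (R.noise k ω)‖ ^ 2 ∂μ ≤ 3 * L ^ 2 * R.devSq μ k
      + 6 * L * (Fintype.card ι * R.meanGap μ xs k)
      + 3 * (Fintype.card ι * noiseLevel R.𝒟 R.F xs ^ 2) := by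
  rw [card_mul_noiseLevel_sq, integral_norm_embed_sq (h.memLp_noise k)]
  refine le_trans (Finset.sum_le_sum fun n _ => ?_) (h.sum_local_bound_le k _)
  have hpast : Past ({.inr (k, n)}ᶜ : Set (ℕ ⊕ ℕ × ι)) k := past_sample_compl le_rfl n
  exact (h.costs.integral_gradNoise_comp_sq_le h.L_nonneg (h.random.infoOn_le _)
    (h.random.measurable_sample k n) (h.random.law k n) (h.random.indep_infoOn_compl_sample k n)
    (measurable_stack_apply (h.measurable_state hpast) (.inl n)) (h.measurable_avg hpast)
    (integrable_norm_sq (h.memLp_state_sub_avg k n))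
    (h.costs.integrable_localGap h.L_nonneg n (h.memLp_avg k))).2

end Setting

end Run

/-! ### The deviations over a block of rounds -/

theorem norm_sum_sq_le {α E : Type*} [SeminormedAddCommGroup E] (s : Finset α) (f : α → E) :
    ‖∑ a ∈ s, f a‖ ^ 2 ≤ s.card * ∑ a ∈ s, ‖f a‖ ^ 2 :=
  (pow_le_pow_left₀ (norm_nonneg _) (norm_sum_le s f) 2).trans sq_sum_le_card_mul_sum_sq

theorem norm_sub_smul_add_sq_le {E : Type*} [NormedAddCommGroup E] [InnerProductSpace ℝ E]
    (b m n : E) (c : ℝ) {p : ℝ} (hp : 0 < p) (hp1 : p ≤ 1) :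
    ‖b - c • (m + n)‖ ^ 2 ≤ (1 + p / 2) * ‖b‖ ^ 2 + 4 / p * c ^ 2 * ‖m‖ ^ 2
      + (2 * c ^ 2 * ‖n‖ ^ 2 - 2 * c * inner ℝ b n) := by
  have hexpand : ‖b - c • (m + n)‖ ^ 2 = ‖b‖ ^ 2 - 2 * c * inner ℝ b m - 2 * c * inner ℝ b n
      + c ^ 2 * ‖m + n‖ ^ 2 := by
    rw [norm_sub_sq_real, inner_smul_right, inner_add_right, norm_smul, mul_pow,
      Real.norm_eq_abs, sq_abs]
    ring
  have hsum : c ^ 2 * ‖m + n‖ ^ 2 ≤ c ^ 2 * (2 * (‖m‖ ^ 2 + ‖n‖ ^ 2)) := by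
    gcongr
    exact (pow_le_pow_left₀ (norm_nonneg _) (norm_add_le m n) 2).trans add_sq_le
  have hyoung : 0 ≤ p / 2 * ‖b‖ ^ 2 + 2 * c * inner ℝ b m + 2 / p * c ^ 2 * ‖m‖ ^ 2 := by
    have hsq : 0 ≤ 2 / p * ‖(p / 2) • b + c • m‖ ^ 2 := by positivity
    rw [norm_add_sq_real, inner_smul_left, inner_smul_right, norm_smul, norm_smul, mul_pow,
      mul_pow, Real.norm_eq_abs, Real.norm_eq_abs, sq_abs, sq_abs, conj_trivial] at hsq
    refine hsq.trans_eq ?_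
    field_simp
  have hp2 : 2 * (c ^ 2 * ‖m‖ ^ 2) ≤ 2 / p * (c ^ 2 * ‖m‖ ^ 2) := by
    have : 2 ≤ 2 / p := by rw [le_div_iff₀ hp]; linarith
    gcongr
  rw [hexpand]
  linear_combination hsum + hyoung + hp2

section Products

variable {ι κ Ω Ξ : Type*} [Fintype ι] [DecidableEq ι] [Fintype κ] [DecidableEq κ]
  [MeasurableSpace Ξ] (W : ℕ → Ω → Matrix (ι ⊕ κ) (ι ⊕ κ) ℝ) (ξ : ℕ → ι → Ω → Ξ)

theorem measurable_gossipProd_sample_compl (s r k : ℕ) (n : ι) (i j : ι ⊕ κ) :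
    Measurable[infoOn W ξ {.inr (k, n)}ᶜ] fun ω => gossipProd W s r ω i j :=
  measurable_gossipProd (fun _ _ _ =>
    measurable_weight_infoOn (Set.mem_compl_singleton_iff.2 Sum.inl_ne_inr)) i j

theorem measurable_centredProd_sample_compl (π : ι ⊕ κ → ℝ) (s r k : ℕ) (n : ι) (i j : ι ⊕ κ) :
    Measurable[infoOn W ξ {.inr (k, n)}ᶜ] fun ω => centredProd W π s r ω i j :=
  measurable_centredProd (fun _ _ _ =>
    measurable_weight_infoOn (Set.mem_compl_singleton_iff.2 Sum.inl_ne_inr)) i j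

end Products

namespace Setting

variable {ι κ Ω Ξ : Type*} [Fintype ι] [DecidableEq ι] [Fintype κ] [DecidableEq κ]
  [MeasurableSpace Ω] [MeasurableSpace Ξ] {d : ℕ} {R : Run ι κ Ω Ξ d} {μ : Measure Ω} {p : ℝ}
  {τ : ℕ} {β L : ℝ} {xs : EuclideanSpace ℝ (Fin d)}

section Propagation

variable {g : ℕ → Ω → ι → EuclideanSpace ℝ (Fin d)}

theorem memLp_act_embed (h : Setting R μ p τ β L xs)
    (hg : ∀ k n, Measurable[infoOn R.W R.ξ (weightsFrom ι k)ᶜ] fun ω => g k ω n)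
    (hg2 : ∀ k n, MemLp (fun ω => g k ω n) 2 μ) (s : ℕ) {r l : ℕ} (hr : r ≤ τ)
    (hl : l ∈ Finset.range r) :
    MemLp (fun ω => act (centredProd R.W R.π (s + l) (r - l) ω) (embed κ (g (s + l) ω))) 2 μ ∧
      ∫ ω, ‖act (centredProd R.W R.π (s + l) (r - l) ω) (embed κ (g (s + l) ω))‖ ^ 2 ∂μ
        ≤ β ^ 2 * ∫ ω, ‖embed κ (g (s + l) ω)‖ ^ 2 ∂μ :=
  h.memLp_centredProd_act (Nat.sub_pos_of_lt (Finset.mem_range.1 hl)) ((Nat.sub_le r l).trans hr)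
    (measurable_embed (hg _)) (memLp_embed (hg2 _))

theorem memLp_propagated (h : Setting R μ p τ β L xs)
    (hg : ∀ k n, Measurable[infoOn R.W R.ξ (weightsFrom ι k)ᶜ] fun ω => g k ω n)
    (hg2 : ∀ k n, MemLp (fun ω => g k ω n) 2 μ) (s : ℕ) {r : ℕ} (hr : r ≤ τ) :
    MemLp (R.propagated g s r) 2 μ :=
  memLp_finsetSum _ fun _ hl => (h.memLp_act_embed hg hg2 s hr hl).1

theorem integral_propagated_sq_le (h : Setting R μ p τ β L xs)
    (hg : ∀ k n, Measurable[infoOn R.W R.ξ (weightsFrom ι k)ᶜ] fun ω => g k ω n)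
    (hg2 : ∀ k n, MemLp (fun ω => g k ω n) 2 μ) (s : ℕ) {r : ℕ} (hr : r ≤ τ) :
    ∫ ω, ‖R.propagated g s r ω‖ ^ 2 ∂μ
      ≤ τ * β ^ 2 * ∑ l ∈ Finset.range r, ∫ ω, ‖embed κ (g (s + l) ω)‖ ^ 2 ∂μ := by
  have hact := fun l hl => h.memLp_act_embed hg hg2 s hr (l := l) hl
  have hint := fun l hl => integrable_norm_sq (hact l hl).1
  calc ∫ ω, ‖R.propagated g s r ω‖ ^ 2 ∂μ
      ≤ ∫ ω, (r : ℝ) * ∑ l ∈ Finset.range r,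
          ‖act (centredProd R.W R.π (s + l) (r - l) ω) (embed κ (g (s + l) ω))‖ ^ 2 ∂μ := by
        refine integral_mono (integrable_norm_sq (h.memLp_propagated hg hg2 s hr))
          ((integrable_finsetSum _ hint).const_mul _) fun ω => ?_
        exact (norm_sum_sq_le _ _).trans_eq (by rw [Finset.card_range])
    _ ≤ r * (β ^ 2 * ∑ l ∈ Finset.range r, ∫ ω, ‖embed κ (g (s + l) ω)‖ ^ 2 ∂μ) := by
        rw [integral_const_mul, integral_finsetSum _ hint, Finset.mul_sum _ _ (β ^ 2)]
        gcongr with l hl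
        exact (hact l hl).2
    _ ≤ τ * β ^ 2 * ∑ l ∈ Finset.range r, ∫ ω, ‖embed κ (g (s + l) ω)‖ ^ 2 ∂μ := by
        rw [mul_assoc]
        gcongr

end Propagation

theorem ae_dev_eq (h : Setting R μ p τ β L xs) (s r : ℕ) : ∀ᵐ ω ∂μ, R.dev (s + r) ω
    = act (gossipProd R.W s r ω - limitMatrix R.π) (R.dev s ω)
      - R.η • (R.propagated R.meanGrad s r ω + R.propagated R.noise s r ω) := by
  filter_upwards [h.gossip.ae_fixesLimit] with ω hω
  have hgrad : R.grad = fun k ω => R.meanGrad k ω + R.noise k ω :=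
    funext fun k => funext fun ω => Run.grad_eq_meanGrad_add_noise k ω
  rw [Run.dev_add hω, hgrad, Run.propagated_add]

variable [∀ n, IsProbabilityMeasure (R.𝒟 n)]

theorem measurable_noise_weightsFrom (h : Setting R μ p τ β L xs) (k : ℕ) (n : ι) :
    Measurable[infoOn R.W R.ξ (weightsFrom ι k)ᶜ] fun ω => R.noise k ω n :=
  h.measurable_noise (past_weightsFrom_compl le_rfl) (inr_mem_weightsFrom_compl k (k, n))

variable [IsProbabilityMeasure μ]

theorem integral_inner_noise (h : Setting R μ p τ β L xs) (k : ℕ) (n : ι)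
    {Z : Ω → EuclideanSpace ℝ (Fin d)} (hZ : Measurable[infoOn R.W R.ξ {.inr (k, n)}ᶜ] Z)
    (hint : Integrable (fun ω => inner ℝ (Z ω) (R.noise k ω n)) μ) :
    ∫ ω, inner ℝ (Z ω) (R.noise k ω n) ∂μ = 0 :=
  h.costs.integral_inner_gradNoise h.L_nonneg (h.random.infoOn_le _)
    (h.random.measurable_sample k n) (h.random.law k n) (h.random.indep_infoOn_compl_sample k n)
    (measurable_stack_apply (h.measurable_state (past_sample_compl le_rfl n)) (.inl n)) hZ hint

theorem memLp_act_noise_single (h : Setting R μ p τ β L xs) {k r : ℕ} (hr : 1 ≤ r) (hrτ : r ≤ τ)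
    (n : ι) : MemLp (fun ω => act (centredProd R.W R.π k r ω)
      (embed κ (Pi.single n (R.noise k ω n)))) 2 μ := by
  refine (h.memLp_centredProd_act hr hrτ (measurable_embed fun m => ?_)
    (memLp_embed fun m => ?_)).1 <;> rcases eq_or_ne m n with rfl | hm
  · simp only [Pi.single_eq_same]
    exact h.measurable_noise (past_weightsFrom_compl le_rfl) (inr_mem_weightsFrom_compl _ _)
  · simp only [Pi.single_eq_of_ne hm]
    exact measurable_const
  · simp only [Pi.single_eq_same]
    exact h.memLp_noise k m
  · simp only [Pi.single_eq_of_ne hm]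
    exact MemLp.zero

theorem integral_inner_act_noise (h : Setting R μ p τ β L xs) {k r : ℕ} (hr : 1 ≤ r) (hrτ : r ≤ τ)
    {Z : Ω → Stack (ι ⊕ κ) (EuclideanSpace ℝ (Fin d))}
    (hZ : ∀ n, Measurable[infoOn R.W R.ξ {.inr (k, n)}ᶜ] Z) (hZ2 : MemLp Z 2 μ) :
    ∫ ω, inner ℝ (Z ω) (act (centredProd R.W R.π k r ω) (embed κ (R.noise k ω))) ∂μ = 0 := by
  have hint := fun n => integrable_inner hZ2 (h.memLp_act_noise_single (k := k) hr hrτ n)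
  simp_rw [embed_eq_sum (R.noise k _), map_sum, inner_sum]
  rw [integral_finsetSum _ fun n _ => hint n]
  refine Finset.sum_eq_zero fun n _ => ?_
  specialize hint n
  simp_rw [inner_act_embed_single] at hint ⊢
  exact h.integral_inner_noise k n (measurable_stack_apply (measurable_act
    (A := fun ω => (centredProd R.W R.π k r ω).transpose)
    (fun i j => measurable_centredProd_sample_compl R.W R.ξ R.π k r k n j i) (hZ n)) _) hint

theorem integral_inner_propagated_noise (h : Setting R μ p τ β L xs) (s : ℕ) {r : ℕ} (hr : r ≤ τ)
    {Z : Ω → Stack (ι ⊕ κ) (EuclideanSpace ℝ (Fin d))}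
    (hZ : ∀ l n, Measurable[infoOn R.W R.ξ {.inr (s + l, n)}ᶜ] Z) (hZ2 : MemLp Z 2 μ) :
    ∫ ω, inner ℝ (Z ω) (R.propagated R.noise s r ω) ∂μ = 0 := by
  simp_rw [Run.propagated, inner_sum]
  rw [integral_finsetSum _ fun l hl => integrable_inner hZ2
    (h.memLp_act_embed h.measurable_noise_weightsFrom h.memLp_noise s hr hl).1]
  exact Finset.sum_eq_zero fun l hl => h.integral_inner_act_noise
    (Nat.sub_pos_of_lt (Finset.mem_range.1 hl)) ((Nat.sub_le r l).trans hr) (hZ l) hZ2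

theorem integral_propagated_noise_sq_le (h : Setting R μ p τ β L xs) (s : ℕ) {r : ℕ}
    (hr : r ≤ τ) :
    ∫ ω, ‖R.propagated R.noise s r ω‖ ^ 2 ∂μ
      ≤ β ^ 2 * ∑ l ∈ Finset.range r, ∫ ω, ‖embed κ (R.noise (s + l) ω)‖ ^ 2 ∂μ := by
  have hact := fun l hl =>
    h.memLp_act_embed h.measurable_noise_weightsFrom h.memLp_noise s hr (l := l) hl
  have horth : ∀ a ∈ Finset.range r, ∀ b ∈ Finset.range r, a < b →
      ∫ ω, inner ℝ (act (centredProd R.W R.π (s + a) (r - a) ω) (embed κ (R.noise (s + a) ω)))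
        (act (centredProd R.W R.π (s + b) (r - b) ω) (embed κ (R.noise (s + b) ω))) ∂μ = 0 :=
    fun a ha b hb hab => h.integral_inner_act_noise (Nat.sub_pos_of_lt (Finset.mem_range.1 hb))
      ((Nat.sub_le r b).trans hr)
      (fun n => measurable_act (measurable_centredProd_sample_compl R.W R.ξ R.π _ _ _ n)
        (measurable_embed fun m => h.measurable_noise (past_sample_compl (by omega) n)
          (by simp [hab.ne]))) (hact a ha).1
  simp_rw [Run.propagated]
  rw [integral_norm_sum_sq_of_orthogonal _ fun l hl => (hact l hl).1, Finset.mul_sum]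
  · exact Finset.sum_le_sum fun l hl => (hact l hl).2
  · intro a ha b hb hab
    rcases lt_or_gt_of_ne hab with hab | hab
    · exact horth a ha b hb hab
    · simp_rw [real_inner_comm (act (centredProd R.W R.π (s + b) (r - b) _) _)]
      exact horth b hb a ha hab

theorem memLp_contracted_dev (h : Setting R μ p τ β L xs) {s r : ℕ} (hsr : r = τ ∨ s = 0) :
    MemLp (fun ω => act (gossipProd R.W s r ω - limitMatrix R.π) (R.dev s ω)) 2 μ ∧
      ∫ ω, ‖act (gossipProd R.W s r ω - limitMatrix R.π) (R.dev s ω)‖ ^ 2 ∂μ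
        ≤ (1 - p) * R.devSq μ s := by
  rcases hsr with rfl | rfl
  · obtain ⟨hint, hle⟩ := h.gossip.contraction s
    have hneg : ∀ ω, act (gossipProd R.W s r ω - limitMatrix R.π) (R.dev s ω)
        = -act (limitMatrix R.π - gossipProd R.W s r ω) (R.dev s ω) := fun ω => by
      rw [act_sub_matrix, act_sub_matrix, neg_sub]
    have hmeas := fun i j => (measurable_gossipProd (m := infoOn R.W R.ξ (weightsFrom ι s))
      (W := R.W) (s := s) (r := r) (fun k hk _ =>
        measurable_weight_infoOn (Set.mem_image_of_mem Sum.inl hk)) i j).const_sub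
          (limitMatrix R.π i j)
    obtain ⟨hmem, hact⟩ := memLp_act_of_indep (h.random.infoOn_le _) (h.random.infoOn_le _)
      (h.indep_weightsFrom s) (A := fun ω => limitMatrix R.π - gossipProd R.W s r ω) hmeas
      (h.measurable_dev (past_weightsFrom_compl le_rfl)) hint (h.memLp_dev s)
    simp_rw [hneg, norm_neg]
    exact ⟨hmem.neg, hact.trans (mul_le_mul_of_nonneg_right hle (R.devSq_nonneg μ s))⟩
  · simp [Run.devSq, Run.dev_zero h.gossip.sum_eq_one]

theorem integral_inner_contracted_dev_noise (h : Setting R μ p τ β L xs) {s r : ℕ} (hr : r ≤ τ)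
    (hsr : r = τ ∨ s = 0) :
    ∫ ω, inner ℝ (act (gossipProd R.W s r ω - limitMatrix R.π) (R.dev s ω))
      (R.propagated R.noise s r ω) ∂μ = 0 :=
  h.integral_inner_propagated_noise s hr
    (fun l n => measurable_act (A := fun ω => gossipProd R.W s r ω - limitMatrix R.π)
      (fun i j => (measurable_gossipProd_sample_compl R.W R.ξ s r (s + l) n i j).sub_const _)
      (h.measurable_dev (past_sample_compl (Nat.le_add_right s l) n)))
    (h.memLp_contracted_dev hsr).1

theorem devSq_add_le_of_moments (h : Setting R μ p τ β L xs) {s r : ℕ} (hr : r ≤ τ)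
    (hsr : r = τ ∨ s = 0) :
    R.devSq μ (s + r) ≤ (1 + p / 2) * ((1 - p) * R.devSq μ s)
      + 4 / p * R.η ^ 2 * ∫ ω, ‖R.propagated R.meanGrad s r ω‖ ^ 2 ∂μ
      + 2 * R.η ^ 2 * ∫ ω, ‖R.propagated R.noise s r ω‖ ^ 2 ∂μ := by
  have hp := h.gossip.p_pos
  obtain ⟨hB, hBle⟩ := h.memLp_contracted_dev hsr
  have hM := h.memLp_propagated (g := R.meanGrad)
    (fun k => h.measurable_meanGrad (past_weightsFrom_compl le_rfl)) h.memLp_meanGrad s hr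
  have hN := h.memLp_propagated h.measurable_noise_weightsFrom h.memLp_noise s hr
  have hBi := (integrable_norm_sq hB).const_mul (1 + p / 2)
  have hMi := (integrable_norm_sq hM).const_mul (4 / p * R.η ^ 2)
  have hNi := (integrable_norm_sq hN).const_mul (2 * R.η ^ 2)
  have hBNi := (integrable_inner hB hN).const_mul (2 * R.η)
  have hDi : Integrable (fun ω => 2 * R.η ^ 2 * ‖R.propagated R.noise s r ω‖ ^ 2 - 2 * R.η *
      inner ℝ (act (gossipProd R.W s r ω - limitMatrix R.π) (R.dev s ω))
        (R.propagated R.noise s r ω)) μ := hNi.sub hBNi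
  have hyoung : R.devSq μ (s + r) ≤ _ :=
    integral_mono_ae (integrable_norm_sq (h.memLp_dev (s + r))) ((hBi.add hMi).add hDi)
      (by
        filter_upwards [h.ae_dev_eq s r] with ω hω
        rw [hω]
        exact norm_sub_smul_add_sq_le _ _ _ _ hp h.gossip.p_le_one)
  simp only [Pi.add_apply] at hyoung
  rw [integral_add₃ hBi hMi hDi, integral_sub hNi hBNi, integral_const_mul,
    integral_const_mul, integral_const_mul, integral_const_mul,
    h.integral_inner_contracted_dev_noise hr hsr, mul_zero, sub_zero] at hyoung
  refine hyoung.trans ?_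
  gcongr

theorem devSq_add_le (h : Setting R μ p τ β L xs) {s r : ℕ} (hr : r ≤ τ) (hsr : r = τ ∨ s = 0) :
    R.devSq μ (s + r) ≤ (1 - p / 2) * R.devSq μ s + ∑ l ∈ Finset.range r,
      (4 / p * R.η ^ 2 * (τ * β ^ 2) * ∫ ω, ‖embed κ (R.meanGrad (s + l) ω)‖ ^ 2 ∂μ
        + 2 * R.η ^ 2 * β ^ 2 * ∫ ω, ‖embed κ (R.noise (s + l) ω)‖ ^ 2 ∂μ) := by
  have hp := h.gossip.p_pos
  have hcontract : (1 + p / 2) * ((1 - p) * R.devSq μ s) ≤ (1 - p / 2) * R.devSq μ s := by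
    linear_combination p ^ 2 / 2 * R.devSq_nonneg μ s
  have hM := mul_le_mul_of_nonneg_left (h.integral_propagated_sq_le (g := R.meanGrad)
    (fun k => h.measurable_meanGrad (past_weightsFrom_compl le_rfl)) h.memLp_meanGrad s hr)
    (show 0 ≤ 4 / p * R.η ^ 2 by positivity)
  have hN := mul_le_mul_of_nonneg_left (h.integral_propagated_noise_sq_le s hr)
    (show 0 ≤ 2 * R.η ^ 2 by positivity)
  rw [Finset.sum_add_distrib, ← Finset.mul_sum, ← Finset.mul_sum]
  linarith [h.devSq_add_le_of_moments hr hsr]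

end Setting

/-! ### Descent of the average -/

theorem norm_average_sq_le {ι E : Type*} [Fintype ι] [Nonempty ι] [SeminormedAddCommGroup E]
    [NormedSpace ℝ E] (f : ι → E) :
    ‖(1 / (Fintype.card ι : ℝ)) • ∑ n, f n‖ ^ 2 ≤ 1 / Fintype.card ι * ∑ n, ‖f n‖ ^ 2 := by
  have : (0 : ℝ) < Fintype.card ι := Nat.cast_pos.2 Fintype.card_pos
  rw [norm_smul, mul_pow, Real.norm_eq_abs, sq_abs]
  calc (1 / (Fintype.card ι : ℝ)) ^ 2 * ‖∑ n, f n‖ ^ 2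
      ≤ (1 / (Fintype.card ι : ℝ)) ^ 2 * (Fintype.card ι * ∑ n, ‖f n‖ ^ 2) := by
        gcongr
        exact norm_sum_sq_le _ f
    _ = 1 / Fintype.card ι * ∑ n, ‖f n‖ ^ 2 := by field_simp

namespace ConvexCosts

variable {ι Ξ : Type*} [Fintype ι] [Nonempty ι] [MeasurableSpace Ξ] {d : ℕ} {𝒟 : ι → Measure Ξ}
  [∀ n, IsProbabilityMeasure (𝒟 n)] {F : ι → EuclideanSpace ℝ (Fin d) → Ξ → ℝ} {L : ℝ}
  {xs : EuclideanSpace ℝ (Fin d)}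

theorem globalCost_sub_le_inner_mean_gradient (h : ConvexCosts 𝒟 F L xs) (hL : 0 ≤ L)
    (x : ι → EuclideanSpace ℝ (Fin d)) (y : EuclideanSpace ℝ (Fin d)) :
    globalCost 𝒟 F y - globalCost 𝒟 F xs - L / 2 * (1 / Fintype.card ι * ∑ n, ‖x n - y‖ ^ 2)
      ≤ inner ℝ ((1 / (Fintype.card ι : ℝ)) • ∑ n, gradient (localCost 𝒟 F n) (x n)) (y - xs) := by
  rw [real_inner_smul_left, sum_inner]
  calc globalCost 𝒟 F y - globalCost 𝒟 F xs - L / 2 * (1 / Fintype.card ι * ∑ n, ‖x n - y‖ ^ 2)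
      = 1 / Fintype.card ι * ∑ n,
          (localCost 𝒟 F n y - localCost 𝒟 F n xs - L / 2 * ‖x n - y‖ ^ 2) := by
        rw [Finset.sum_sub_distrib, Finset.sum_sub_distrib, ← Finset.mul_sum, globalCost,
          globalCost]
        ring
    _ ≤ 1 / Fintype.card ι * ∑ n, inner ℝ (gradient (localCost 𝒟 F n) (x n)) (y - xs) := by
        gcongr with n
        exact (h.smoothConvex_localCost hL n).sub_sub_le_inner_grad (x n) y xs

theorem norm_mean_gradient_sq_le (h : ConvexCosts 𝒟 F L xs) (hL : 0 ≤ L)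
    (x : ι → EuclideanSpace ℝ (Fin d)) (y : EuclideanSpace ℝ (Fin d)) :
    ‖(1 / (Fintype.card ι : ℝ)) • ∑ n, gradient (localCost 𝒟 F n) (x n)‖ ^ 2
      ≤ 4 * L * (globalCost 𝒟 F y - globalCost 𝒟 F xs)
        + 2 * L ^ 2 * (1 / Fintype.card ι * ∑ n, ‖x n - y‖ ^ 2) := by
  set c : ℝ := 1 / Fintype.card ι
  set m := c • ∑ n, gradient (localCost 𝒟 F n) (x n)
  set g := c • ∑ n, gradient (localCost 𝒟 F n) y
  have hexact : ‖g‖ ^ 2 ≤ 2 * L * (globalCost 𝒟 F y - globalCost 𝒟 F xs) := by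
    simpa only [bregman, h.sum_gradient_eq_zero hL, smul_zero, sub_zero, inner_zero_left]
      using (h.smoothConvex_globalCost hL).norm_grad_sub_sq_le y xs
  have herror : ‖m - g‖ ^ 2 ≤ L ^ 2 * (c * ∑ n, ‖x n - y‖ ^ 2) := by
    rw [← smul_sub, ← Finset.sum_sub_distrib, mul_left_comm, Finset.mul_sum]
    refine (norm_average_sq_le _).trans ?_
    gcongr with n
    rw [← mul_pow]
    exact pow_le_pow_left₀ (norm_nonneg _)
      ((h.smoothConvex_localCost hL n).norm_grad_sub_le (x n) y) 2
  have hsplit : ‖m‖ ^ 2 ≤ 2 * (‖m - g‖ ^ 2 + ‖g‖ ^ 2) := by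
    have htriangle := norm_add_le (m - g) g
    rw [sub_add_cancel] at htriangle
    exact (pow_le_pow_left₀ (norm_nonneg _) htriangle 2).trans add_sq_le
  linarith

theorem norm_sub_mean_gradient_step_sq_le (h : ConvexCosts 𝒟 F L xs) (hL : 0 ≤ L) {η : ℝ}
    (hη : 0 ≤ η) (x : ι → EuclideanSpace ℝ (Fin d)) (y : EuclideanSpace ℝ (Fin d)) :
    ‖y - xs - η • ((1 / (Fintype.card ι : ℝ)) • ∑ n, gradient (localCost 𝒟 F n) (x n))‖ ^ 2
      ≤ ‖y - xs‖ ^ 2 - (2 * η - 4 * η ^ 2 * L) * (globalCost 𝒟 F y - globalCost 𝒟 F xs)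
        + (η * L + 2 * η ^ 2 * L ^ 2) / Fintype.card ι * ∑ n, ‖x n - y‖ ^ 2 := by
  have hinner := mul_le_mul_of_nonneg_left
    (h.globalCost_sub_le_inner_mean_gradient hL x y) hη
  have hnorm := mul_le_mul_of_nonneg_left (h.norm_mean_gradient_sq_le hL x y) (sq_nonneg η)
  rw [norm_sub_sq_real, inner_smul_right, norm_smul, mul_pow, Real.norm_eq_abs, sq_abs,
    real_inner_comm]
  linear_combination 2 * hinner + hnorm

end ConvexCosts

section Run

variable {ι κ Ω Ξ : Type*} [Fintype ι] [Fintype κ] [MeasurableSpace Ξ] {d : ℕ}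

/-- The error of the average after a step along the exact local gradients of round `k`; the actual
error of round `k + 1` differs from it by the averaged gradient noise. -/
def Run.meanStepError (R : Run ι κ Ω Ξ d) (xs : EuclideanSpace ℝ (Fin d)) (k : ℕ) (ω : Ω) :
    EuclideanSpace ℝ (Fin d) :=
  R.avg k ω - xs - R.η • ((1 / (Fintype.card ι : ℝ)) • ∑ n, R.meanGrad k ω n)

theorem Run.avg_succ_sub {R : Run ι κ Ω Ξ d} {ω : Ω} (h : FixesLimit R.W R.π ω)
    (xs : EuclideanSpace ℝ (Fin d)) (k : ℕ) :
    R.avg (k + 1) ω - xs = R.meanStepError xs k ω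
      + (-(R.η / (Fintype.card ι : ℝ))) • ∑ n, R.noise k ω n := by
  rw [Run.avg_succ h, Run.meanStepError, Run.grad_eq_meanGrad_add_noise]
  simp only [Pi.add_apply, Finset.sum_add_distrib]
  module

namespace Setting

variable [MeasurableSpace Ω] [DecidableEq ι] [DecidableEq κ] {R : Run ι κ Ω Ξ d} {μ : Measure Ω}
  {p : ℝ} {τ : ℕ} {β L : ℝ} {xs : EuclideanSpace ℝ (Fin d)} [IsProbabilityMeasure μ]
  [∀ n, IsProbabilityMeasure (R.𝒟 n)]

theorem memLp_meanStepError (h : Setting R μ p τ β L xs) (k : ℕ) :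
    MemLp (R.meanStepError xs k) 2 μ := by
  have hsum : MemLp (fun ω => ∑ n, R.meanGrad k ω n) 2 μ :=
    memLp_finsetSum _ fun n _ => h.memLp_meanGrad k n
  exact ((h.memLp_avg k).sub (memLp_const xs)).sub
    ((hsum.const_smul (1 / (Fintype.card ι : ℝ))).const_smul R.η)

theorem memLp_sum_noise (h : Setting R μ p τ β L xs) (k : ℕ) :
    MemLp (fun ω => ∑ n, R.noise k ω n) 2 μ :=
  memLp_finsetSum _ fun n _ => h.memLp_noise k n

theorem integral_inner_meanStepError_noise (h : Setting R μ p τ β L xs) (k : ℕ) :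
    ∫ ω, inner ℝ (R.meanStepError xs k ω) (∑ n, R.noise k ω n) ∂μ = 0 := by
  have hint := fun n => integrable_inner (h.memLp_meanStepError k) (h.memLp_noise k n)
  simp_rw [inner_sum]
  rw [integral_finsetSum _ fun n _ => hint n]
  refine Finset.sum_eq_zero fun n _ => h.integral_inner_noise k n ?_ (hint n)
  have hpast : Past ({.inr (k, n)}ᶜ : Set (ℕ ⊕ ℕ × ι)) k := past_sample_compl le_rfl n
  have hsum : Measurable[infoOn R.W R.ξ {.inr (k, n)}ᶜ] fun ω => ∑ m, R.meanGrad k ω m :=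
    Finset.measurable_sum _ fun m _ => h.measurable_meanGrad hpast m
  exact ((h.measurable_avg hpast).sub measurable_const).sub
    ((hsum.const_smul (1 / (Fintype.card ι : ℝ))).const_smul R.η)

theorem integral_norm_sum_noise_sq (h : Setting R μ p τ β L xs) (k : ℕ) :
    ∫ ω, ‖∑ n, R.noise k ω n‖ ^ 2 ∂μ = ∫ ω, ‖embed κ (R.noise k ω)‖ ^ 2 ∂μ := by
  rw [integral_norm_embed_sq (h.memLp_noise k)]
  refine integral_norm_sum_sq_of_orthogonal _ (fun n _ => h.memLp_noise k n) fun a _ b _ hab => ?_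
  exact h.integral_inner_noise k b
    (h.measurable_noise (past_sample_compl le_rfl b) (by simpa using hab))
    (integrable_inner (h.memLp_noise k a) (h.memLp_noise k b))

theorem integral_norm_meanStepError_sq_le [Nonempty ι] (h : Setting R μ p τ β L xs)
    (hη : 0 ≤ R.η) (k : ℕ) :
    ∫ ω, ‖R.meanStepError xs k ω‖ ^ 2 ∂μ ≤ ∫ ω, ‖R.avg k ω - xs‖ ^ 2 ∂μ
      - (2 * R.η - 4 * R.η ^ 2 * L) * R.meanGap μ xs k
      + (R.η * L + 2 * R.η ^ 2 * L ^ 2) / Fintype.card ι * R.devSq μ k := by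
  have hL := h.L_nonneg
  have herr : Integrable (fun ω => ‖R.avg k ω - xs‖ ^ 2) μ :=
    integrable_norm_sq ((h.memLp_avg k).sub (memLp_const xs))
  have hgap := (h.integrable_gap k).const_mul (2 * R.η - 4 * R.η ^ 2 * L)
  have hdev := (integrable_norm_sq (h.memLp_dev k)).const_mul
    ((R.η * L + 2 * R.η ^ 2 * L ^ 2) / Fintype.card ι)
  rw [Run.meanGap, Run.devSq, ← integral_const_mul, ← integral_const_mul,
    ← integral_sub herr hgap, ← integral_add (by exact herr.sub hgap) hdev]
  refine integral_mono (integrable_norm_sq (h.memLp_meanStepError k)) ((herr.sub hgap).add hdev)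
    fun ω => (h.costs.norm_sub_mean_gradient_step_sq_le hL hη
      (fun n => R.state k ω (.inl n)) (R.avg k ω)).trans ?_
  gcongr
  exact R.sum_norm_state_sub_avg_sq_le k ω

theorem integral_norm_avg_succ_sub_sq_le [Nonempty ι] (h : Setting R μ p τ β L xs)
    (hη : 0 ≤ R.η) (k : ℕ) :
    ∫ ω, ‖R.avg (k + 1) ω - xs‖ ^ 2 ∂μ ≤ ∫ ω, ‖R.avg k ω - xs‖ ^ 2 ∂μ
      - (2 * R.η - 4 * R.η ^ 2 * L) * R.meanGap μ xs k
      + (R.η * L + 2 * R.η ^ 2 * L ^ 2) / Fintype.card ι * R.devSq μ k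
      + (R.η / Fintype.card ι) ^ 2 * ∫ ω, ‖embed κ (R.noise k ω)‖ ^ 2 ∂μ := by
  have hstep : ∫ ω, ‖R.avg (k + 1) ω - xs‖ ^ 2 ∂μ = ∫ ω, ‖R.meanStepError xs k ω
      + (-(R.η / (Fintype.card ι : ℝ))) • ∑ n, R.noise k ω n‖ ^ 2 ∂μ := by
    refine integral_congr_ae ?_
    filter_upwards [h.gossip.ae_fixesLimit] with ω hω
    rw [Run.avg_succ_sub hω]
  have hnoise : MemLp (fun ω => (-(R.η / (Fintype.card ι : ℝ))) • ∑ n, R.noise k ω n) 2 μ :=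
    (h.memLp_sum_noise k).const_smul (-(R.η / (Fintype.card ι : ℝ)))
  rw [hstep, integral_norm_add_sq (h.memLp_meanStepError k) hnoise]
  simp_rw [inner_smul_right, norm_smul, mul_pow, norm_neg, Real.norm_eq_abs, sq_abs]
  rw [integral_const_mul, integral_const_mul, h.integral_inner_meanStepError_noise,
    h.integral_norm_sum_noise_sq, mul_zero, mul_zero, add_zero]
  gcongr
  exact h.integral_norm_meanStepError_sq_le hη k

end Setting

end Run

/-! ### Real recursions -/

section RealRecursions

theorem sum_range_tsub {u : ℕ → ℝ} (h0 : u 0 = 0) (τ K : ℕ) :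
    ∑ k ∈ Finset.range K, u (k - τ) = ∑ k ∈ Finset.range (K - τ), u k := by
  induction K with
  | zero => simp
  | succ K ih =>
    rw [Finset.sum_range_succ, ih]
    rcases lt_or_ge K τ with hK | hK
    · rw [Nat.sub_eq_zero_of_le hK.le, Nat.sub_eq_zero_of_le hK, h0, add_zero]
    · rw [Nat.succ_sub hK, Finset.sum_range_succ]

theorem sum_range_sum_Ico_le {e : ℕ → ℝ} (he : ∀ k, 0 ≤ e k) (τ K : ℕ) :
    ∑ k ∈ Finset.range K, ∑ l ∈ Finset.Ico (k - τ) k, e l ≤ τ * ∑ k ∈ Finset.range K, e k := by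
  rw [Finset.sum_comm' (t' := Finset.range K)
    (s' := fun l => (Finset.Ioc l (l + τ)).filter (· < K)) fun k l => by grind, Finset.mul_sum]
  refine Finset.sum_le_sum fun l _ => ?_
  have hcard := Finset.card_filter_le (Finset.Ioc l (l + τ)) (· < K)
  rw [Nat.card_Ioc, add_tsub_cancel_left] at hcard
  rw [Finset.sum_const, nsmul_eq_mul]
  exact mul_le_mul_of_nonneg_right (Nat.cast_le.2 hcard) (he l)

theorem sum_le_of_block_contraction {u e : ℕ → ℝ} {p : ℝ} {τ : ℕ} (hp : 0 < p) (hp1 : p ≤ 1)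
    (h0 : u 0 = 0) (hu : ∀ k, 0 ≤ u k) (he : ∀ k, 0 ≤ e k)
    (h : ∀ k, u k ≤ (1 - p / 2) * u (k - τ) + ∑ l ∈ Finset.Ico (k - τ) k, e l) (K : ℕ) :
    ∑ k ∈ Finset.range K, u k ≤ 2 * τ / p * ∑ k ∈ Finset.range K, e k := by
  have hsum := Finset.sum_le_sum fun k (_ : k ∈ Finset.range K) => h k
  rw [Finset.sum_add_distrib, ← Finset.mul_sum, sum_range_tsub h0] at hsum
  have hshift : ∑ k ∈ Finset.range (K - τ), u k ≤ ∑ k ∈ Finset.range K, u k :=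
    Finset.sum_le_sum_of_subset_of_nonneg (Finset.range_mono (Nat.sub_le _ _)) fun k _ _ => hu k
  have hcontract := mul_le_mul_of_nonneg_left hshift (show 0 ≤ 1 - p / 2 by linarith)
  rw [div_mul_eq_mul_div, le_div_iff₀ hp]
  linarith [sum_range_sum_Ico_le he τ K]

theorem sum_range_le_of_le_affine {f u v : ℕ → ℝ} {a b m c : ℝ}
    (h : ∀ k, f k ≤ a * u k + b * (m * v k) + c) (K : ℕ) :
    ∑ k ∈ Finset.range K, f k ≤ a * ∑ k ∈ Finset.range K, u k
      + b * (m * ∑ k ∈ Finset.range K, v k) + K * c := by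
  refine (Finset.sum_le_sum fun k _ => h k).trans_eq ?_
  simp only [Finset.sum_add_distrib, ← Finset.mul_sum, Finset.sum_const, Finset.card_range,
    nsmul_eq_mul]

variable {N K L p τ : ℝ}

theorem dev_le_of_sums {a ζ σ T U E M V : ℝ} (hN : 0 ≤ N) (hK : 0 ≤ K) (ha : 0 ≤ a) (hp : 0 ≤ p)
    (hpτ : p ≤ τ) (hE : 0 ≤ E) (hT : ζ ^ 2 * τ ^ 2 + σ ^ 2 * (p * τ) ≤ T ^ 2)
    (hU : U ≤ 8 * a * τ ^ 2 * M + 4 * a * (p * τ) * V)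
    (hM : M ≤ E + K * (3 * (N * ζ ^ 2))) (hV : V ≤ E + K * (3 * (N * σ ^ 2))) :
    U ≤ 12 * a * τ ^ 2 * E + 24 * (K * N * (a * T ^ 2)) := by
  have hτ : 0 ≤ τ := hp.trans hpτ
  have hspare : 0 ≤ 12 * (K * N * a) * (σ ^ 2 * (p * τ)) := by positivity
  linear_combination hU + 8 * a * τ ^ 2 * hM + 4 * a * (p * τ) * hV + 4 * a * τ * E * hpτ
    + 24 * (K * N * a) * hT + hspare

theorem mul_dev_div_le {a G U D : ℝ} (hN : 0 < N) (hK : 0 ≤ K) (hL : 0 ≤ L) (hG : 0 ≤ G)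
    (hU0 : 0 ≤ U) (hD : 0 ≤ D) (haL : a * τ ^ 2 * L ^ 2 ≤ 1 / 1600)
    (hU : U ≤ 12 * a * τ ^ 2 * (3 * L ^ 2 * U + 6 * L * (N * D)) + 24 * (K * N * G)) :
    L * U / N ≤ D / 20 + 25 * (K * (L * G)) := by
  rw [div_le_iff₀ hN]
  have hscaled := mul_le_mul_of_nonneg_left hU hL
  have hdev := mul_le_mul_of_nonneg_right haL (show 0 ≤ L * U by positivity)
  have hgap := mul_le_mul_of_nonneg_right haL (show 0 ≤ N * D by positivity)
  have hspare : 0 ≤ K * (L * G) * N := by positivity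
  have hspare' : 0 ≤ N * D := by positivity
  linarith

theorem mul_gap_le_of_descent {η σ G U D V r r' : ℝ} (hN : 1 ≤ N) (hK : 0 ≤ K) (hL : 0 ≤ L)
    (hη : 0 ≤ η) (hG : 0 ≤ G) (hU : 0 ≤ U) (hD : 0 ≤ D) (hr' : 0 ≤ r') (hηL : η * L ≤ 1 / 40)
    (hLU : L * U / N ≤ D / 20 + 25 * (K * (L * G)))
    (hV : V ≤ 3 * L ^ 2 * U + 6 * L * (N * D) + K * (3 * (N * σ ^ 2)))
    (hdescent : r' ≤ r - (2 * η - 4 * η ^ 2 * L) * D + (η * L + 2 * η ^ 2 * L ^ 2) / N * U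
      + (η / N) ^ 2 * V) :
    η * D ≤ r + η * K * (29 * (L * G) + 3 * (η * σ ^ 2 / N)) := by
  have hN0 : 0 < N := one_pos.trans_le hN
  set X := L * U / N with hX
  have hX0 : 0 ≤ X := by positivity
  have hnoise : (η / N) ^ 2 * V
      ≤ 3 * η ^ 2 * L * X + 6 * η ^ 2 * L * D + η * K * (3 * (η * σ ^ 2 / N)) := by
    calc (η / N) ^ 2 * V
        ≤ (η / N) ^ 2 * (3 * L ^ 2 * U + 6 * L * (N * D) + K * (3 * (N * σ ^ 2))) := by gcongr
      _ = 1 / N * (3 * η ^ 2 * L * X + 6 * η ^ 2 * L * D) + η * K * (3 * (η * σ ^ 2 / N)) := by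
          rw [hX]; field_simp
      _ ≤ 1 * (3 * η ^ 2 * L * X + 6 * η ^ 2 * L * D) + η * K * (3 * (η * σ ^ 2 / N)) := by
          gcongr
          rwa [div_le_one hN0]
      _ = 3 * η ^ 2 * L * X + 6 * η ^ 2 * L * D + η * K * (3 * (η * σ ^ 2 / N)) := by ring
  have hdev : (η * L + 2 * η ^ 2 * L ^ 2) / N * U = η * X + 2 * η * (η * L) * X := by
    rw [hX]; field_simp
  rw [hdev] at hdescent
  have hX40 := mul_le_mul_of_nonneg_right hηL (show 0 ≤ η * X by positivity)
  have hD40 := mul_le_mul_of_nonneg_right hηL (show 0 ≤ η * D by positivity)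
  have hX20 := mul_le_mul_of_nonneg_left hLU hη
  have hspare : 0 ≤ η * (K * (L * G)) := by positivity
  have hspare' : 0 ≤ η * D := by positivity
  linarith

end RealRecursions

/-! ### The step size -/

theorem exists_stepSize {ε r A : ℝ} (hε : 0 < ε) (hr : 0 ≤ r) (hA : 0 ≤ A) :
    ∃ η : ℝ, 0 < η ∧ η * (ε * A) ≤ 1 / 40 ∧
      ∀ K : ℝ, 1 ≤ K → 80 * (A * r) ≤ K → r ≤ η * K * (ε / 2) := by
  rcases hA.eq_or_lt with rfl | hA
  · refine ⟨2 * r / ε + 1, by positivity, by simp, fun K hK _ => ?_⟩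
    calc r ≤ (2 * r / ε + 1) * 1 * (ε / 2) := by field_simp; linarith
      _ ≤ (2 * r / ε + 1) * K * (ε / 2) := by gcongr
  · refine ⟨1 / (40 * (ε * A)), by positivity, by field_simp; rfl, fun K _ hK => ?_⟩
    calc r ≤ K / (80 * A) := by rw [le_div_iff₀ (by positivity)]; linarith
      _ = 1 / (40 * (ε * A)) * K * (ε / 2) := by field_simp; norm_num

section IterationOrder

variable {N : ℕ} {L β p σ ζ ε : ℝ} {τ : ℕ}

theorem iterationOrder_nonneg (hβ : 0 ≤ β) (hL : 0 ≤ L) (hp : 0 ≤ p) (hσ : 0 ≤ σ) (hζ : 0 ≤ ζ)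
    (hε : 0 ≤ ε) : 0 ≤ iterationOrder N L β p τ σ ζ ε := by
  unfold iterationOrder
  positivity

theorem mul_iterationOrder (hε : 0 < ε) :
    ε * iterationOrder N L β p τ σ ζ ε = σ ^ 2 / (N * ε)
      + β * √L * (ζ * τ + σ * √(p * τ)) / (p * √ε) + β * L * τ / p := by
  have hpow : ε ^ (3 / 2 : ℝ) = ε * √ε := by
    rw [show (3 / 2 : ℝ) = 1 + 1 / 2 by norm_num, Real.rpow_add hε, Real.rpow_one,
      Real.sqrt_eq_rpow]
  rw [iterationOrder, hpow]
  field_simp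

theorem bounds_of_mul_iterationOrder_le {η : ℝ} (hN : 0 < N) (hβ : 0 ≤ β) (hL : 0 ≤ L)
    (hp : 0 < p) (hσ : 0 ≤ σ) (hζ : 0 ≤ ζ) (hε : 0 < ε) (hη : 0 ≤ η)
    (h : η * (ε * iterationOrder N L β p τ σ ζ ε) ≤ 1 / 40) :
    η * σ ^ 2 / N ≤ ε / 40 ∧
      L * ((η * β / p) ^ 2 * (ζ * τ + σ * √(p * τ)) ^ 2) ≤ ε / 1600 ∧
      η * β * τ / p * L ≤ 1 / 40 := by
  set T := ζ * τ + σ * √(p * τ)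
  rw [mul_iterationOrder hε, mul_add, mul_add] at h
  have hnoise : 0 ≤ η * (σ ^ 2 / (N * ε)) := by positivity
  have hdrift : 0 ≤ η * (β * √L * T / (p * √ε)) := by positivity
  have hsmooth : 0 ≤ η * (β * L * τ / p) := by positivity
  refine ⟨?_, ?_, ?_⟩
  · calc η * σ ^ 2 / N = η * (σ ^ 2 / (N * ε)) * ε := by field_simp
      _ ≤ 1 / 40 * ε := by gcongr; linarith
      _ = ε / 40 := by ring
  · calc L * ((η * β / p) ^ 2 * T ^ 2) = (η * (β * √L * T / (p * √ε))) ^ 2 * ε := by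
          simp only [mul_pow, div_pow, Real.sq_sqrt hL, Real.sq_sqrt hε.le]
          field_simp
      _ ≤ (1 / 40) ^ 2 * ε := by gcongr; linarith
      _ = ε / 1600 := by ring
  · calc η * β * τ / p * L = η * (β * L * τ / p) := by ring
      _ ≤ 1 / 40 := by linarith

end IterationOrder

/-! ### Summing the recursions -/

namespace Setting

variable {ι κ Ω Ξ : Type*} [Fintype ι] [DecidableEq ι] [Fintype κ] [DecidableEq κ]
  [MeasurableSpace Ω] [MeasurableSpace Ξ] {d : ℕ} {R : Run ι κ Ω Ξ d} {μ : Measure Ω}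
  {p : ℝ} {τ : ℕ} {β L : ℝ} {xs : EuclideanSpace ℝ (Fin d)}

theorem meanGap_nonneg (h : Setting R μ p τ β L xs) (k : ℕ) : 0 ≤ R.meanGap μ xs k :=
  integral_nonneg fun _ => sub_nonneg.2 (h.costs.minimizer _)

variable [IsProbabilityMeasure μ] [∀ n, IsProbabilityMeasure (R.𝒟 n)]

theorem sum_devSq_le (h : Setting R μ p τ β L xs) (K : ℕ) :
    ∑ k ∈ Finset.range K, R.devSq μ k
      ≤ 8 * (R.η * β / p) ^ 2 * τ ^ 2
          * ∑ k ∈ Finset.range K, ∫ ω, ‖embed κ (R.meanGrad k ω)‖ ^ 2 ∂μ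
        + 4 * (R.η * β / p) ^ 2 * (p * τ)
          * ∑ k ∈ Finset.range K, ∫ ω, ‖embed κ (R.noise k ω)‖ ^ 2 ∂μ := by
  have hp := h.gossip.p_pos
  have hsq : ∀ f : Ω → Stack (ι ⊕ κ) (EuclideanSpace ℝ (Fin d)), 0 ≤ ∫ ω, ‖f ω‖ ^ 2 ∂μ :=
    fun f => integral_nonneg fun ω => sq_nonneg _
  have hsum := sum_le_of_block_contraction (u := R.devSq μ) (τ := τ)
    (e := fun k => 4 / p * R.η ^ 2 * (τ * β ^ 2) * ∫ ω, ‖embed κ (R.meanGrad k ω)‖ ^ 2 ∂μ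
        + 2 * R.η ^ 2 * β ^ 2 * ∫ ω, ‖embed κ (R.noise k ω)‖ ^ 2 ∂μ) hp h.gossip.p_le_one
    (by simp [Run.devSq, Run.dev_zero h.gossip.sum_eq_one]) (R.devSq_nonneg μ)
    (fun k => add_nonneg (mul_nonneg (by positivity) (hsq _)) (mul_nonneg (by positivity) (hsq _)))
    (fun k => by
      have hblock := h.devSq_add_le (s := k - τ) (r := k - (k - τ)) (by omega) (by omega)
      rwa [Nat.add_sub_cancel' (Nat.sub_le k τ), ← Finset.sum_Ico_eq_sum_range (f := fun l =>
        4 / p * R.η ^ 2 * (τ * β ^ 2) * ∫ ω, ‖embed κ (R.meanGrad l ω)‖ ^ 2 ∂μ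
          + 2 * R.η ^ 2 * β ^ 2 * ∫ ω, ‖embed κ (R.noise l ω)‖ ^ 2 ∂μ)] at hblock) K
  rw [Finset.sum_add_distrib, ← Finset.mul_sum, ← Finset.mul_sum] at hsum
  refine hsum.trans_eq ?_
  field_simp
  ring

variable [Nonempty ι]

theorem integral_globalCost_avg (h : Setting R μ p τ β L xs) (k : ℕ) :
    ∫ ω, globalCost R.𝒟 R.F (R.avg k ω) ∂μ = R.meanGap μ xs k + globalCost R.𝒟 R.F xs := by
  rw [Run.meanGap, integral_sub (h.costs.integrable_globalCost h.L_nonneg (h.memLp_avg k))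
    (integrable_const _), integral_const, probReal_univ, one_smul, sub_add_cancel]

theorem integral_norm_avg_sub_sq_le (h : Setting R μ p τ β L xs) (hη : 0 ≤ R.η) (K : ℕ) :
    ∫ ω, ‖R.avg K ω - xs‖ ^ 2 ∂μ ≤ ‖R.x₀ - xs‖ ^ 2
      - (2 * R.η - 4 * R.η ^ 2 * L) * ∑ k ∈ Finset.range K, R.meanGap μ xs k
      + (R.η * L + 2 * R.η ^ 2 * L ^ 2) / Fintype.card ι * ∑ k ∈ Finset.range K, R.devSq μ k
      + (R.η / Fintype.card ι) ^ 2
        * ∑ k ∈ Finset.range K, ∫ ω, ‖embed κ (R.noise k ω)‖ ^ 2 ∂μ := by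
  induction K with
  | zero => simp [Run.avg_zero h.gossip.sum_eq_one]
  | succ K ih =>
    simp only [Finset.sum_range_succ, mul_add]
    linarith [h.integral_norm_avg_succ_sub_sq_le hη K]

theorem mul_sum_meanGap_le (h : Setting R μ p τ β L xs) (hη : 0 < R.η) (hpβ : p ≤ β * τ)
    (hstep : R.η * β * τ / p * L ≤ 1 / 40) (K : ℕ) :
    R.η * ∑ k ∈ Finset.range K, R.meanGap μ xs k ≤ ‖R.x₀ - xs‖ ^ 2 + R.η * K
      * (29 * (L * ((R.η * β / p) ^ 2 * (heterogeneity R.𝒟 R.F xs * τ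
          + noiseLevel R.𝒟 R.F xs * √(p * τ)) ^ 2))
        + 3 * (R.η * noiseLevel R.𝒟 R.F xs ^ 2 / Fintype.card ι)) := by
  have hp := h.gossip.p_pos
  have hL := h.L_nonneg
  have hβ := h.gossip.beta_pos
  have hN : (1 : ℝ) ≤ Fintype.card ι := Nat.one_le_cast.2 Fintype.card_pos
  have hτ : (1 : ℝ) ≤ τ := Nat.one_le_cast.2 h.gossip.one_le_tau
  have hζ : 0 ≤ heterogeneity R.𝒟 R.F xs := Real.sqrt_nonneg _
  have hσ : 0 ≤ noiseLevel R.𝒟 R.F xs := Real.sqrt_nonneg _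
  have hU := Finset.sum_nonneg fun k (_ : k ∈ Finset.range K) => R.devSq_nonneg μ k
  have hD := Finset.sum_nonneg fun k (_ : k ∈ Finset.range K) => h.meanGap_nonneg k
  have hT : heterogeneity R.𝒟 R.F xs ^ 2 * τ ^ 2 + noiseLevel R.𝒟 R.F xs ^ 2 * (p * τ)
      ≤ (heterogeneity R.𝒟 R.F xs * τ + noiseLevel R.𝒟 R.F xs * √(p * τ)) ^ 2 := by
    have hcross : 0 ≤ heterogeneity R.𝒟 R.F xs * τ * (noiseLevel R.𝒟 R.F xs * √(p * τ)) := by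
      positivity
    rw [add_sq, mul_pow, mul_pow, Real.sq_sqrt (by positivity)]
    linarith
  have hηq : R.η ≤ R.η * β * τ / p := by
    rw [le_div_iff₀ hp, mul_assoc]
    gcongr
  have haL : (R.η * β / p) ^ 2 * τ ^ 2 * L ^ 2 ≤ 1 / 1600 :=
    calc (R.η * β / p) ^ 2 * τ ^ 2 * L ^ 2 = (R.η * β * τ / p * L) ^ 2 := by ring
      _ ≤ (1 / 40) ^ 2 := by gcongr
      _ = 1 / 1600 := by norm_num
  have hV := sum_range_le_of_le_affine h.integral_noise_sq_le K
  have hdev := dev_le_of_sums (by positivity) (Nat.cast_nonneg K) (sq_nonneg _) hp.le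
    (h.gossip.p_le_one.trans hτ) (by positivity) hT (h.sum_devSq_le K)
    (sum_range_le_of_le_affine h.integral_meanGrad_sq_le K) hV
  have hLdev := mul_dev_div_le (by positivity) (Nat.cast_nonneg K) hL (by positivity) hU hD haL hdev
  exact mul_gap_le_of_descent hN (Nat.cast_nonneg K) hL hη.le (by positivity) hU hD
    (integral_nonneg fun _ => sq_nonneg _)
    ((mul_le_mul_of_nonneg_right hηq hL).trans hstep) hLdev hV
    (h.integral_norm_avg_sub_sq_le hη.le K)

theorem average_gap_le (h : Setting R μ p τ β L xs) (hη : 0 < R.η) (hpβ : p ≤ β * τ) {ε : ℝ}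
    (hε : 0 < ε) (hstep : R.η * (ε * iterationOrder (Fintype.card ι) L β p τ
      (noiseLevel R.𝒟 R.F xs) (heterogeneity R.𝒟 R.F xs) ε) ≤ 1 / 40) {K : ℕ} (hK : 1 ≤ K)
    (hdist : ‖R.x₀ - xs‖ ^ 2 ≤ R.η * K * (ε / 2)) :
    (1 / (K : ℝ)) * ∑ k ∈ Finset.range K, ∫ ω, globalCost R.𝒟 R.F (R.avg k ω) ∂μ
      - globalCost R.𝒟 R.F xs ≤ ε := by
  have hK0 : (0 : ℝ) < K := Nat.cast_pos.2 hK
  obtain ⟨hnoise, hdrift, hsmooth⟩ := bounds_of_mul_iterationOrder_le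
    (σ := noiseLevel R.𝒟 R.F xs) (ζ := heterogeneity R.𝒟 R.F xs) Fintype.card_pos
    h.gossip.beta_pos.le h.L_nonneg h.gossip.p_pos (Real.sqrt_nonneg _) (Real.sqrt_nonneg _) hε
    hη.le hstep
  have hsum : R.η * ∑ k ∈ Finset.range K, R.meanGap μ xs k ≤ R.η * (ε * K) :=
    calc R.η * ∑ k ∈ Finset.range K, R.meanGap μ xs k
        ≤ R.η * K * (ε / 2) + R.η * K * (29 * (ε / 1600) + 3 * (ε / 40)) := by
          refine (h.mul_sum_meanGap_le hη hpβ hsmooth K).trans ?_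
          gcongr
      _ = R.η * K * ε * (1 / 2 + 29 / 1600 + 3 / 40) := by ring
      _ ≤ R.η * K * ε * 1 := by gcongr; norm_num
      _ = R.η * (ε * K) := by ring
  calc (1 / (K : ℝ)) * ∑ k ∈ Finset.range K, ∫ ω, globalCost R.𝒟 R.F (R.avg k ω) ∂μ
        - globalCost R.𝒟 R.F xs
      = (∑ k ∈ Finset.range K, R.meanGap μ xs k) / K := by
        simp_rw [h.integral_globalCost_avg, Finset.sum_add_distrib, Finset.sum_const,
          Finset.card_range, nsmul_eq_mul]
        field_simp
        ring
    _ ≤ ε := by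
        rw [div_le_iff₀ hK0]
        exact le_of_mul_le_mul_left hsum hη

end Setting

end DTGO

end

theorem theorem1 :
    -- an absolute constant
    ∃ C : ℝ, 0 < C ∧
      ∀ (ι κ Ω Ξ : Type*) [Fintype ι] [DecidableEq ι] [Nonempty ι] [Fintype κ] [DecidableEq κ]
        [MeasurableSpace Ω] [MeasurableSpace Ξ] (d : ℕ)
        (μ : Measure Ω) [IsProbabilityMeasure μ]
        (𝒟 : ι → Measure Ξ) [∀ n, IsProbabilityMeasure (𝒟 n)]
        (F : ι → EuclideanSpace ℝ (Fin d) → Ξ → ℝ) (ξ : ℕ → ι → Ω → Ξ)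
        (W : ℕ → Ω → Matrix (ι ⊕ κ) (ι ⊕ κ) ℝ) (π : ι ⊕ κ → ℝ)
        (p : ℝ) (τ : ℕ) (β L : ℝ) (xs x₀ : EuclideanSpace ℝ (Fin d)),
        DTGO.RandomModel μ W 𝒟 ξ →
        DTGO.GossipAssumption μ W π p τ β →
        -- `β` is an upper bound, taken not too small
        p ≤ β * τ →
        0 ≤ L →
        DTGO.ConvexCosts 𝒟 F L xs →
        ∀ ε : ℝ, 0 < ε →
          ∃ η : ℝ, 0 < η ∧
            (∀ k, Integrable (fun ω => DTGO.globalCost 𝒟 F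
              (DTGO.weightedAverage π (DTGO.iterate W F π ξ η x₀ k ω))) μ) ∧
            ∀ K : ℕ, 1 ≤ K →
              C * (DTGO.iterationOrder (Fintype.card ι) L β p τ
                  (DTGO.noiseLevel 𝒟 F xs) (DTGO.heterogeneity 𝒟 F xs) ε
                * ‖DTGO.weightedAverage π (fun _ : ι ⊕ κ => x₀) - xs‖ ^ 2) ≤ K →
              (1 / (K : ℝ)) * ∑ k ∈ Finset.range K,
                  ∫ ω, DTGO.globalCost 𝒟 F
                    (DTGO.weightedAverage π (DTGO.iterate W F π ξ η x₀ k ω)) ∂μ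
                - DTGO.globalCost 𝒟 F xs ≤ ε := by
  refine ⟨80, by norm_num, ?_⟩
  intro ι κ Ω Ξ _ _ _ _ _ _ _ d μ _ 𝒟 _ F ξ W π p τ β L xs x₀ hR hG hpβ hL hC ε hε
  obtain ⟨η, hη, hstep, hdist⟩ := DTGO.exists_stepSize hε (sq_nonneg ‖x₀ - xs‖)
    (DTGO.iterationOrder_nonneg (N := Fintype.card ι) (τ := τ)
      (σ := DTGO.noiseLevel 𝒟 F xs) (ζ := DTGO.heterogeneity 𝒟 F xs) hG.beta_pos.le hL hG.p_pos.le
      (Real.sqrt_nonneg _) (Real.sqrt_nonneg _) hε.le)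
  let R : DTGO.Run ι κ Ω Ξ d := ⟨𝒟, F, W, π, ξ, η, x₀⟩
  have h : DTGO.Setting R μ p τ β L xs := ⟨hR, hG, hC, hL⟩
  refine ⟨η, hη, fun k => hC.integrable_globalCost hL (h.memLp_avg k), fun K hK hle => ?_⟩
  rw [DTGO.weightedAverage_const hG.sum_eq_one] at hle
  exact h.average_gap_le hη hpβ hε hstep hK (hdist K (Nat.one_le_cast.2 hK) hle)
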